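/- Setting. Let $M$ be a smooth $4$-manifold with a Galilei metric $(h,\tau)$: $\tau$ is a smooth nowhere vanishing one-form, and $h$ is a smooth symmetric positive semidefinite contravariant $2$-tensor of rank $3$ with $h^{\mu\nu}\tau_\nu=0$. Put $g=\tau\otimes\tau$. A symmetric Galilei connection is a smooth torsion-free linear connection $\nabla$ with $\nabla\tau=0$ and $\nabla h=0$. A timelike unit field is a smooth vector field $V$ with $\tau(V)=1$; for such a $V$, let ${}^V\Gamma$ be the symmetric Galilei connection for which $V$ satisfies $V^\rho V^\alpha{}_{;\rho}=0$ and $h^{\rho\alpha}V^\beta{}_{;\rho}-h^{\rho\beta}V^\alpha{}_{;\rho}=0$. The connection is Newtonian if it is a symmetric Galilei connection and $\Gamma^\mu_{\alpha\beta}={}^V\Gamma^\mu_{\alpha\beta}+\tau_\alpha\kappa_{\beta\lambda}h^{\lambda\mu}+\tau_\beta\kappa_{\alpha\lambda}h^{\lambda\mu}$ for some timelike unit field $V$ and some smooth closed two-form $\kappa$. Let $G>0$ and $\Lambda$ be real constants. A dust solution of the Newton–Cartan theory consists of such an $(M,h,\tau)$ with a Newtonian connection, a smooth function $\rho$ (the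 density) and a timelike unit field $u$ (the velocity) such that $T=\rho\,u\otimes u$ satisfies $$\nabla_\beta T^{\alpha\beta}=0,\qquad R_{\alpha\beta}=8\pi G\left(T_{\alpha\beta}-\tfrac12 g_{\alpha\beta}T\right)-\Lambda g_{\alpha\beta},$$ where $T_{\alpha\beta}=g_{\alpha\sigma}g_{\beta\rho}T^{\sigma\rho}$ and $T=g_{\sigma\rho}T^{\sigma\rho}$ (that is, $R_{\alpha\beta}=(4\pi G\rho-\Lambda)\tau_\alpha\tau_\beta$). Let $$\Omega^{\alpha\beta}=\tfrac12\left(u^\alpha{}_{;\lambda}h^{\lambda\beta}-u^\beta{}_{;\lambda}h^{\lambda\alpha}\right),\qquad \Theta^{\alpha\beta}=\tfrac12\left(u^\alpha{}_{;\lambda}h^{\lambda\beta}+u^\beta{}_{;\lambda}h^{\lambda\alpha}\right),\qquad \theta=u^\sigma{}_{;\sigma}$$ be the vorticity, strain and expansion of $u$. The velocity field $u$ is static if $\Omega^{\alpha\beta}=0$, $L_u\theta=0$ and $L_u\Theta^{\alpha\beta}=0$. No further symmetry is assumed. Claim. (1) If $\Lambda=0$, no static dust solution has $\rho>0$ at any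 point; the condition $L_u\Theta^{\alpha\beta}=0$ is not even needed here. (2) If $\Lambda>0$, the only static dust solution is, locally, the Einstein universe. More precisely, in every static dust solution, at every point where $\rho\neq0$ (in particular everywhere, if $\rho>0$), and also at every point near which $\nabla_u u=0$, one has $$\rho=\frac{\Lambda}{4\pi G},$$ and at such points $\nabla u=0$ and the curvature tensor of the connection vanishes. Conversely, there is a static dust solution on $\mathbb R^4$ with $\rho=\Lambda/(4\pi G)$ everywhere. -/

import Mathlib

open scoped Manifold ContDiff Bundle

noncomputable section

namespace NewtonCartan

/-- The model space `ℝ⁴` of a spacetime manifold. -/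
abbrev R4 : Type := EuclideanSpace ℝ (Fin 4)

/-- The tangent space `T_x M`. -/
abbrev TSpace (M : Type*) [TopologicalSpace M] [ChartedSpace R4 M] (x : M) : Type :=
  TangentSpace (𝓡 4) x

/-- The cotangent space `T_x^* M`. -/
abbrev CSpace (M : Type*) [TopologicalSpace M] [ChartedSpace R4 M] (x : M) : Type :=
  TSpace M x →L[ℝ] ℝ

/-- A linear connection on `M` (Mathlib's covariant derivatives on the tangent bundle):
`D Y x v` is `(∇_v Y)(x)`. -/
abbrev Connection (M : Type*) [TopologicalSpace M] [ChartedSpace R4 M] [IsManifold (𝓡 4) ∞ M] :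
    Type _ :=
  CovariantDerivative (𝓡 4) R4 (TSpace M)

section Basic

variable {M : Type*} [TopologicalSpace M] [ChartedSpace R4 M] [IsManifold (𝓡 4) ∞ M]

/-- The vector field `X` is smooth on the set `U`. -/
def SmoothVectorOn (X : Π x : M, TSpace M x) (U : Set M) : Prop :=
  ContMDiffOn (𝓡 4) ((𝓡 4).prod 𝓘(ℝ, R4)) ∞
    (fun x ↦ (⟨x, X x⟩ : Bundle.TotalSpace R4 (TSpace M))) U

/-- The one-form `α` is smooth on the set `U`. -/
def SmoothFormOn (α : Π x : M, CSpace M x) (U : Set M) : Prop :=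
  ContMDiffOn (𝓡 4) ((𝓡 4).prod 𝓘(ℝ, R4 →L[ℝ] ℝ)) ∞
    (fun x ↦ (⟨x, α x⟩ : Bundle.TotalSpace (R4 →L[ℝ] ℝ) (CSpace M))) U

/-- The connection `D` is smooth: on every open set, `∇Y` is smooth when `Y` is. -/
def SmoothConnection (D : Connection M) : Prop :=
  ∀ U : Set M, IsOpen U → ContMDiffCovariantDerivativeOn (I := 𝓡 4) R4 ∞ D.toFun U

/-- The derivative `v(f)` of the function `f` in the direction `v ∈ T_x M`. -/
def dirDeriv (f : M → ℝ) (x : M) (v : TSpace M x) : ℝ :=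
  mfderiv (𝓡 4) 𝓘(ℝ, ℝ) f x v

/-- The Lie bracket `[X, Y]`. -/
def bracket (X Y : Π x : M, TSpace M x) : Π x : M, TSpace M x :=
  VectorField.mlieBracket (𝓡 4) X Y

/-- The `i`-th vector of the coordinate basis of `T_x M` given by the preferred chart at `x`. -/
def basisVec (x : M) (i : Fin 4) : TSpace M x :=
  (EuclideanSpace.single i 1 : R4)

/-- The dual basis of `T_x^* M`. -/
def basisCovec (x : M) (i : Fin 4) : CSpace M x :=
  (EuclideanSpace.proj i : R4 →L[ℝ] ℝ)

/-- The coordinate vector field `∂_i` of the preferred chart at `x`. -/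
def coordField (x : M) (i : Fin 4) : Π y : M, TSpace M y :=
  FiberBundle.extend R4 (basisVec x i)

/-- The coordinate one-form `dx^i` of the preferred chart at `x`. -/
def coordForm (x : M) (i : Fin 4) : Π y : M, CSpace M y :=
  FiberBundle.extend (R4 →L[ℝ] ℝ) (basisCovec x i)

/-! ### Contravariant symmetric tensor fields of rank two

Such a field `S` is represented by the maps `T_x^* M → T_x M`, `β ↦ S(·, β)`, so that
`S(α, β) = α (S β)`. -/

/-- `(∇_v α)(Y) = v(α(Y)) - α(∇_v Y)` at `x`. -/
def covForm (D : Connection M) (α : Π x : M, CSpace M x) (Y : Π x : M, TSpace M x) (x : M)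
    (v : TSpace M x) : ℝ :=
  dirDeriv (fun y ↦ α y (Y y)) x v - α x (D Y x v)

/-- `(∇_v S)(α, β) = v(S(α, β)) - S(∇_v α, β) - S(α, ∇_v β)` at `x`, for a symmetric contravariant
tensor field `S`. -/
def covTensor (D : Connection M) (S : Π x : M, CSpace M x → TSpace M x)
    (α β : Π x : M, CSpace M x) (x : M) (v : TSpace M x) : ℝ :=
  dirDeriv (fun y ↦ α y (S y (β y))) x v
    - covForm D α (fun y ↦ S y (β y)) x v - covForm D β (fun y ↦ S y (α y)) x v

/-- The divergence `(∇_β S^{αβ}) α_α` at `x` of a symmetric contravariant tensor field `S`, paired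
with the one-form `α`. -/
def divTensor (D : Connection M) (S : Π x : M, CSpace M x → TSpace M x)
    (α : Π x : M, CSpace M x) (x : M) : ℝ :=
  ∑ i, covTensor D S α (coordForm x i) x (basisVec x i)

/-- `(L_u α)(Y) = u(α(Y)) - α([u, Y])` at `x`. -/
def lieForm (u : Π x : M, TSpace M x) (α : Π x : M, CSpace M x) (Y : Π x : M, TSpace M x)
    (x : M) : ℝ :=
  dirDeriv (fun y ↦ α y (Y y)) x (u x) - α x (bracket u Y x)

/-- `(L_u S)(α, β) = u(S(α, β)) - S(L_u α, β) - S(α, L_u β)` at `x`, for a symmetric contravariant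
tensor field `S`. -/
def lieTensor (u : Π x : M, TSpace M x) (S : Π x : M, CSpace M x → TSpace M x)
    (α β : Π x : M, CSpace M x) (x : M) : ℝ :=
  dirDeriv (fun y ↦ α y (S y (β y))) x (u x)
    - lieForm u α (fun y ↦ S y (β y)) x - lieForm u β (fun y ↦ S y (α y)) x

/-! ### Curvature -/

/-- `R(X, Y)Z = ∇_X ∇_Y Z - ∇_Y ∇_X Z - ∇_{[X, Y]} Z`. -/
def curvature (D : Connection M) (X Y Z : Π x : M, TSpace M x) (x : M) : TSpace M x :=
  D (fun y ↦ D Z y (Y y)) x (X x) - D (fun y ↦ D Z y (X y)) x (Y x) - D Z x (bracket X Y x)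

/-- The Ricci tensor `Ric(X, Y) = R^α_{σαβ} X^σ Y^β`, the trace of `Z ↦ R(Z, Y)X`. -/
def ricci (D : Connection M) (X Y : Π x : M, TSpace M x) (x : M) : ℝ :=
  ∑ i, basisCovec x i (curvature D (coordField x i) Y X x)

end Basic

/-- A Galilei metric on a four-dimensional manifold: a nowhere vanishing one-form `τ` and a
symmetric positive semidefinite contravariant tensor field `h` whose null covectors are
exactly the multiples of `τ` (so `h` has rank three and `h(·, τ) = 0`). The tensor `h` is given by
`sharp : α ↦ α^♯ = h(·, α)`, so `h(α, β) = α (sharp β)`. -/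
structure GalileiMetric (M : Type*) [TopologicalSpace M] [ChartedSpace R4 M]
    [IsManifold (𝓡 4) ∞ M] where
  τ : Π x : M, CSpace M x
  sharp : Π x : M, CSpace M x →L[ℝ] TSpace M x
  smooth_τ : SmoothFormOn τ Set.univ
  smooth_sharp : ContMDiff (𝓡 4) ((𝓡 4).prod 𝓘(ℝ, (R4 →L[ℝ] ℝ) →L[ℝ] R4)) ∞
    (fun x ↦ (⟨x, sharp x⟩ : Bundle.TotalSpace ((R4 →L[ℝ] ℝ) →L[ℝ] R4)
      (fun x : M ↦ CSpace M x →L[ℝ] TSpace M x)))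
  τ_ne_zero : ∀ x, τ x ≠ 0
  symm : ∀ x (α β : CSpace M x), α (sharp x β) = β (sharp x α)
  nonneg : ∀ x (α : CSpace M x), 0 ≤ α (sharp x α)
  sharp_τ : ∀ x, sharp x (τ x) = 0
  null : ∀ x (α : CSpace M x), α (sharp x α) = 0 → ∃ c : ℝ, α = c • τ x

section Theory

variable {M : Type*} [TopologicalSpace M] [ChartedSpace R4 M] [IsManifold (𝓡 4) ∞ M]

/-- A smooth symmetric Galilei connection: torsion free with `∇τ = 0` and `∇h = 0`. -/
structure IsGalileiConnection (𝔤 : GalileiMetric M) (D : Connection M) : Prop where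
  smooth : SmoothConnection D
  torsion_free : D.torsion = 0
  τ_parallel : ∀ (U : Set M), IsOpen U → ∀ Y, SmoothVectorOn Y U → ∀ x ∈ U, ∀ v : TSpace M x,
    covForm D 𝔤.τ Y x v = 0
  h_parallel : ∀ (U : Set M), IsOpen U → ∀ α β, SmoothFormOn α U → SmoothFormOn β U →
    ∀ x ∈ U, ∀ v : TSpace M x, covTensor D (fun y ↦ 𝔤.sharp y) α β x v = 0

/-- A smooth timelike unit vector field. -/
structure IsTimelikeUnit (𝔤 : GalileiMetric M) (u : Π x : M, TSpace M x) : Prop where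
  smooth : SmoothVectorOn u Set.univ
  unit : ∀ x, 𝔤.τ x (u x) = 1

/-- The acceleration `∇_u u`. -/
def acceleration (D : Connection M) (u : Π x : M, TSpace M x) (x : M) : TSpace M x :=
  D u x (u x)

/-- The vorticity tensor
`Ω^{αβ} = (u^α_{;λ} h^{λβ} - u^β_{;λ} h^{λα}) / 2` evaluated on covectors at `x`. -/
def vorticity (𝔤 : GalileiMetric M) (D : Connection M) (u : Π x : M, TSpace M x) (x : M)
    (α β : CSpace M x) : ℝ :=
  (1 / 2) * (α (D u x (𝔤.sharp x β)) - β (D u x (𝔤.sharp x α)))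

/-- The strain tensor `Θ^{αβ} = (u^α_{;λ} h^{λβ} + u^β_{;λ} h^{λα}) / 2`, as the map
`β ↦ Θ(·, β)`. -/
def strain (𝔤 : GalileiMetric M) (D : Connection M) (u : Π x : M, TSpace M x) (x : M)
    (β : CSpace M x) : TSpace M x :=
  (1 / 2 : ℝ) • (D u x (𝔤.sharp x β) + 𝔤.sharp x (β.comp (D u x)))

/-- The expansion `θ = u^σ_{;σ}`. -/
def expansion (D : Connection M) (u : Π x : M, TSpace M x) (x : M) : ℝ :=
  LinearMap.trace ℝ (TSpace M x) (D u x : TSpace M x →ₗ[ℝ] TSpace M x)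

/-- A smooth closed two-form `κ`. -/
structure IsClosedTwoForm (κ : Π x : M, TSpace M x →L[ℝ] TSpace M x →L[ℝ] ℝ) : Prop where
  smooth : ContMDiff (𝓡 4) ((𝓡 4).prod 𝓘(ℝ, R4 →L[ℝ] R4 →L[ℝ] ℝ)) ∞
    (fun x ↦ (⟨x, κ x⟩ : Bundle.TotalSpace (R4 →L[ℝ] R4 →L[ℝ] ℝ)
      (fun x : M ↦ TSpace M x →L[ℝ] TSpace M x →L[ℝ] ℝ)))
  alternating : ∀ x v, κ x v v = 0
  closed : ∀ U : Set M, IsOpen U → ∀ X Y Z, SmoothVectorOn X U → SmoothVectorOn Y U →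
    SmoothVectorOn Z U → ∀ x ∈ U,
      dirDeriv (fun y ↦ κ y (Y y) (Z y)) x (X x)
        + dirDeriv (fun y ↦ κ y (Z y) (X y)) x (Y x)
        + dirDeriv (fun y ↦ κ y (X y) (Y y)) x (Z x)
        - κ x (bracket X Y x) (Z x) - κ x (bracket Y Z x) (X x) - κ x (bracket Z X x) (Y x) = 0

/-- `D` is the symmetric Galilei connection for which the timelike unit field `V` is
geodesic and free of rotation. -/
structure IsSpecialConnection (𝔤 : GalileiMetric M) (V : Π x : M, TSpace M x)
    (D : Connection M) : Prop where
  galilei : IsGalileiConnection 𝔤 D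
  geodesic : ∀ x, acceleration D V x = 0
  irrotational : ∀ x α β, vorticity 𝔤 D V x α β = 0

/-- A Newtonian connection: `Γ^μ_{αβ} = ^VΓ^μ_{αβ} + 2 τ_{(α} κ_{β)λ} h^{λμ}` for a
timelike unit vector field `V` and a closed two-form `κ`. -/
structure IsNewtonianConnection (𝔤 : GalileiMetric M) (D : Connection M) : Prop where
  galilei : IsGalileiConnection 𝔤 D
  newtonian : ∃ (V : Π x : M, TSpace M x) (D₀ : Connection M)
    (κ : Π x : M, TSpace M x →L[ℝ] TSpace M x →L[ℝ] ℝ),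
      IsTimelikeUnit 𝔤 V ∧ IsSpecialConnection 𝔤 V D₀ ∧ IsClosedTwoForm κ ∧
      ∀ U : Set M, IsOpen U → ∀ Y, SmoothVectorOn Y U → ∀ x ∈ U, ∀ v : TSpace M x,
        D Y x v = D₀ Y x v
          + (𝔤.τ x v • 𝔤.sharp x (κ x (Y x)) + 𝔤.τ x (Y x) • 𝔤.sharp x (κ x v))

/-- The field equations `R_{αβ} = 8πG (T_{αβ} - g_{αβ} T / 2) - Λ g_{αβ}` with the time metric
`g = τ ⊗ τ`, `T_{αβ} = g_{ασ} g_{βρ} T^{σρ}` and `T = g_{σρ} T^{σρ}`. -/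
def FieldEquations (G Λ : ℝ) (𝔤 : GalileiMetric M) (D : Connection M)
    (T : Π x : M, CSpace M x → TSpace M x) : Prop :=
  ∀ U : Set M, IsOpen U → ∀ X Y, SmoothVectorOn X U → SmoothVectorOn Y U → ∀ x ∈ U,
    ricci D X Y x =
      8 * Real.pi * G *
        ((𝔤.τ x (X x) • 𝔤.τ x) (T x (𝔤.τ x (Y x) • 𝔤.τ x))
          - (1 / 2) * (𝔤.τ x (X x) * 𝔤.τ x (Y x)) * 𝔤.τ x (T x (𝔤.τ x)))
      - Λ * (𝔤.τ x (X x) * 𝔤.τ x (Y x))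

/-- The energy-momentum tensor `T = ρ u ⊗ u` of a pressureless ideal fluid. -/
def dustTensor (ρ : M → ℝ) (u : Π x : M, TSpace M x) (x : M) (β : CSpace M x) : TSpace M x :=
  (ρ x * β (u x)) • u x

/-- A dust solution of the Newton–Cartan theory with gravitational constant `G` and cosmological
constant `Λ`. -/
structure IsDustSolution (G Λ : ℝ) (𝔤 : GalileiMetric M) (D : Connection M) (ρ : M → ℝ)
    (u : Π x : M, TSpace M x) : Prop where
  newtonian : IsNewtonianConnection 𝔤 D
  smooth_density : ContMDiff (𝓡 4) 𝓘(ℝ, ℝ) ∞ ρ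
  velocity : IsTimelikeUnit 𝔤 u
  conservation : ∀ U : Set M, IsOpen U → ∀ α, SmoothFormOn α U → ∀ x ∈ U,
    divTensor D (dustTensor ρ u) α x = 0
  field : FieldEquations G Λ 𝔤 D (dustTensor ρ u)

/-- Vanishing vorticity, `Ω^♯ = 0`. -/
def VorticityFree (𝔤 : GalileiMetric M) (D : Connection M) (u : Π x : M, TSpace M x) : Prop :=
  ∀ x α β, vorticity 𝔤 D u x α β = 0

/-- Stationary expansion, `L_u θ = 0`. -/
def ExpansionStationary (D : Connection M) (u : Π x : M, TSpace M x) : Prop :=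
  ∀ x, dirDeriv (expansion D u) x (u x) = 0

/-- Stationary strain, `L_u Θ^♯ = 0`. -/
def StrainStationary (𝔤 : GalileiMetric M) (D : Connection M) (u : Π x : M, TSpace M x) : Prop :=
  ∀ U : Set M, IsOpen U → ∀ α β, SmoothFormOn α U → SmoothFormOn β U → ∀ x ∈ U,
    lieTensor u (strain 𝔤 D u) α β x = 0

/-- A static velocity field. -/
structure IsStatic (𝔤 : GalileiMetric M) (D : Connection M) (u : Π x : M, TSpace M x) : Prop where
  vorticity : VorticityFree 𝔤 D u
  expansion : ExpansionStationary D u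
  strain : StrainStationary 𝔤 D u

/-- The curvature tensor of the connection `D` vanishes at the point `x`. -/
def FlatAt (D : Connection M) (x : M) : Prop :=
  ∀ U : Set M, IsOpen U → x ∈ U → ∀ X Y Z, SmoothVectorOn X U → SmoothVectorOn Y U →
    SmoothVectorOn Z U → curvature D X Y Z x = 0

end Theory

end NewtonCartan

end

/-!
The argument is local and takes place in a chart around a point `x`. There a symmetric Galilei
connection and a timelike unit field `u` become a Christoffel map, a clock form, a space metric and
a vector field on an open subset of `ℝ⁴` (`IsGalileiChart`,
`IsGalileiConnection.isGalileiChart`). Write `A = ∇u`. Its values are annihilated by `τ`.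

* The `τ`-component of `div (ρ u ⊗ u) = 0` is the continuity equation, and the remaining components
  say `ρ ∇_u u = 0` (`IsDustSolution.density_smul_acceleration`). Hence `u` is geodesic near every
  point with `ρ ≠ 0`.
* For a geodesic `u` the Ricci identity gives `Ric(u, u) = -u(θ) - tr A²`
  (`trace_christoffelCurvature_self`). If `u(θ) = 0`, the field equations turn this into
  `tr A² = Λ - 4πGρ`. Without vorticity `A` is a symmetric matrix in an adapted orthonormal frame,
  so `tr A² ≥ 0`, with equality only for `A = 0` (`IsGalileiTriple.trace_sq_nonneg`). For `Λ = 0` this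
  excludes `ρ > 0`.
* For a geodesic vorticity-free `u` one has `L_u Θ = (∇_u A - 2 A²) ∘ h`
  (`IsGalileiChart.lie_strain`). If it vanishes, then `∇_u A = 2 A²`, and the trace
  `u(θ) = 2 tr A²` is zero, so `A = 0` and `4πGρ = Λ`.
* Then the connection is Ricci-flat near `x` and `u` is parallel there. Metricity and the Bianchi
  identity reduce the curvature to the curvature tensor of a three-dimensional space, which is
  determined by the Ricci tensor (`IsGalileiTriple.curvature_eq_zero`), so it vanishes.

The Einstein universe itself is `ℝ⁴` with the flat connection, `τ = dx⁰`, `h = diag(0, 1, 1, 1)`,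
`u = ∂₀` and constant density (`isDustSolution_flat`).
-/

namespace NewtonCartan

/-! ### Linear algebra of a Galilei metric at a point -/

section Pointwise

variable {E : Type*} [AddCommGroup E] [Module ℝ E]

/-- The algebraic data of a Galilei metric on a vector space, together with an observer: a clock
form `τ`, a space metric `H` on covectors whose null covectors are the multiples of `τ`, and a
vector `u` with `τ u = 1`. -/
structure IsGalileiTriple (τ : Module.Dual ℝ E) (H : Module.Dual ℝ E →ₗ[ℝ] E) (u : E) : Prop where
  symm : ∀ α β : Module.Dual ℝ E, α (H β) = β (H α)
  nonneg : ∀ α : Module.Dual ℝ E, 0 ≤ α (H α)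
  apply_τ : H τ = 0
  null : ∀ α : Module.Dual ℝ E, α (H α) = 0 → ∃ c : ℝ, α = c • τ
  unit : τ u = 1

variable {τ : Module.Dual ℝ E} {H : Module.Dual ℝ E →ₗ[ℝ] E} {u : E}

theorem IsGalileiTriple.τ_apply (hT : IsGalileiTriple τ H u) (β : Module.Dual ℝ E) :
    τ (H β) = 0 := by
  rw [hT.symm, hT.apply_τ, map_zero]

/-- The covectors annihilating `u` form a Euclidean space of dimension three under `H`; an
orthonormal basis `θ` of it provides the frame `u, H θ₀, H θ₁, H θ₂` with dual frame
`τ, θ₀, θ₁, θ₂`. -/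
theorem IsGalileiTriple.exists_frame (hT : IsGalileiTriple τ H u) (hE : Module.finrank ℝ E = 4) :
    ∃ θ : Fin 3 → Module.Dual ℝ E, (∀ a b, θ a (H (θ b)) = if a = b then 1 else 0) ∧
      (∀ a, θ a u = 0) ∧ ∀ v, v = τ v • u + ∑ a, θ a v • H (θ a) := by
  classical
  have : FiniteDimensional ℝ E := FiniteDimensional.of_finrank_pos (by omega)
  have hu : Module.Dual.eval ℝ E u ≠ 0 := fun h ↦ by
    simpa [hT.unit] using LinearMap.congr_fun h τ
  set K : Submodule ℝ (Module.Dual ℝ E) := LinearMap.ker (Module.Dual.eval ℝ E u) with hK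
  have hmem : ∀ α : K, (α : Module.Dual ℝ E) u = 0 := fun α ↦ α.2
  have hdim : Module.finrank ℝ K = 3 := by
    have := Module.Dual.finrank_ker_add_one_of_ne_zero hu
    rw [Subspace.dual_finrank_eq, hE] at this
    exact Nat.succ_injective this
  let core : InnerProductSpace.Core ℝ K :=
    { inner := fun α β ↦ (α : Module.Dual ℝ E) (H β)
      conj_inner_symm := fun α β ↦ by simp [hT.symm (α : Module.Dual ℝ E) β]
      re_inner_nonneg := fun α ↦ by simpa using hT.nonneg α
      add_left := fun α β γ ↦ by simp
      smul_left := fun α β r ↦ by simp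
      definite := fun α h ↦ by
        obtain ⟨c, hc⟩ := hT.null α h
        have h0 := hmem α
        rw [hc] at h0
        have : c = 0 := by simpa [hT.unit] using h0
        ext1
        simp [hc, this] }
  let _ : NormedAddCommGroup K := core.toNormedAddCommGroup
  let _ : InnerProductSpace ℝ K := InnerProductSpace.ofCore core.toCore
  have hinner : ∀ α β : K, inner ℝ α β = (α : Module.Dual ℝ E) (H β) := fun _ _ ↦ rfl
  let b : OrthonormalBasis (Fin 3) ℝ K :=
    (stdOrthonormalBasis ℝ K).reindex (finCongr hdim)
  have hb : ∀ a c, (b a : Module.Dual ℝ E) (H (b c)) = if a = c then 1 else 0 := fun a c ↦ by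
    rw [← hinner, orthonormal_iff_ite.1 b.orthonormal]
  refine ⟨fun a ↦ b a, hb, fun a ↦ hmem _, fun v ↦ ?_⟩
  rw [← sub_eq_zero, ← Module.forall_dual_apply_eq_zero_iff ℝ]
  have key : ∀ β : K, (β : Module.Dual ℝ E)
      (v - (τ v • u + ∑ a, (b a : Module.Dual ℝ E) v • H (b a))) = 0 := fun β ↦ by
    have h1 := congrArg (fun γ : K ↦ (γ : Module.Dual ℝ E) v) (b.sum_repr' β)
    simp only [AddSubmonoidClass.coe_finsetSum, SetLike.val_smul, LinearMap.sum_apply,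
      LinearMap.smul_apply, smul_eq_mul, hinner] at h1
    simp only [map_sub, map_add, map_smul, map_sum, hmem, smul_eq_mul, mul_zero, zero_add]
    rw [← h1, sub_eq_zero]
    exact Finset.sum_congr rfl fun a _ ↦ by
      rw [hT.symm β (b a : Module.Dual ℝ E), mul_comm]
  intro α
  have hα : α - α u • τ ∈ K := by
    change (α - α u • τ) u = 0
    simp [hT.unit]
  have h2 := key ⟨_, hα⟩
  have h3 : τ (v - (τ v • u + ∑ a, (b a : Module.Dual ℝ E) v • H (b a))) = 0 := by
    simp [hT.unit, hT.τ_apply]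
  simpa [h3] using h2

theorem IsGalileiTriple.ext_linearMap (hT : IsGalileiTriple τ H u) (hE : Module.finrank ℝ E = 4)
    {B C : E →ₗ[ℝ] E} (hu : B u = C u) (hH : ∀ β, B (H β) = C (H β)) : B = C := by
  obtain ⟨θ, -, -, hv⟩ := hT.exists_frame hE
  ext v
  rw [hv v]
  simp [hu, hH]

variable [FiniteDimensional ℝ E]

theorem trace_eq_of_frame {θ : Fin 3 → Module.Dual ℝ E}
    (hθ : ∀ v, v = τ v • u + ∑ a, θ a v • H (θ a)) (B : E →ₗ[ℝ] E) :
    LinearMap.trace ℝ E B = τ (B u) + ∑ a, θ a (B (H (θ a))) := by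
  have : B = τ.smulRight (B u) + ∑ a, (θ a).smulRight (B (H (θ a))) := by
    ext v
    conv_lhs => rw [hθ v]
    simp
  conv_lhs => rw [this]
  simp [map_sum]

/-- For a vorticity-free `A = ∇u` with `A u = 0`, the matrix of `A` in an adapted orthonormal
frame is symmetric, so `tr A²` is the sum of the squares of its entries. -/
theorem IsGalileiTriple.trace_sq_nonneg (hT : IsGalileiTriple τ H u) (hE : Module.finrank ℝ E = 4)
    {A : E →ₗ[ℝ] E} (hτ : ∀ v, τ (A v) = 0) (hu : A u = 0)
    (hA : ∀ α β : Module.Dual ℝ E, α (A (H β)) = β (A (H α))) :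
    0 ≤ LinearMap.trace ℝ E (A ∘ₗ A) ∧ (LinearMap.trace ℝ E (A ∘ₗ A) = 0 → A = 0) := by
  obtain ⟨θ, -, -, hv⟩ := hT.exists_frame hE
  have hexp : ∀ a, A (H (θ a)) = ∑ b, θ b (A (H (θ a))) • H (θ b) := fun a ↦ by
    conv_lhs => rw [hv (A (H (θ a))), hτ, zero_smul, zero_add]
  have htr : LinearMap.trace ℝ E (A ∘ₗ A) = ∑ a, ∑ b, (θ a (A (H (θ b)))) ^ 2 := by
    rw [trace_eq_of_frame hv]
    simp only [LinearMap.comp_apply, hu, map_zero, zero_add]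
    refine Finset.sum_congr rfl fun a _ ↦ ?_
    conv_lhs => rw [hexp a]
    simp only [map_sum, map_smul, smul_eq_mul]
    refine Finset.sum_congr rfl fun b _ ↦ ?_
    rw [hA (θ b) (θ a), sq]
  refine ⟨htr ▸ by positivity, fun h0 ↦ ?_⟩
  rw [htr, Finset.sum_eq_zero_iff_of_nonneg fun _ _ ↦ by positivity] at h0
  have h1 : ∀ a b, θ a (A (H (θ b))) = 0 := fun a b ↦ by
    have := (Finset.sum_eq_zero_iff_of_nonneg fun _ _ ↦ by positivity).1
      (h0 a (Finset.mem_univ a)) b (Finset.mem_univ b)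
    simpa using this
  ext v
  rw [hv v]
  have h2 : ∀ a, A (H (θ a)) = 0 := fun a ↦ by rw [hexp a]; simp [h1]
  simp [map_sum, hu, h2]

/-- A skew-symmetric function of two indices out of three vanishes if three of its values do. -/
theorem eq_zero_of_skew {f : Fin 3 → Fin 3 → ℝ} (hf : ∀ a b, f a b = -f b a) (h01 : f 0 1 = 0)
    (h02 : f 0 2 = 0) (h12 : f 1 2 = 0) (a b : Fin 3) : f a b = 0 := by
  have h00 := hf 0 0
  have h11 := hf 1 1
  have h22 := hf 2 2
  have h10 := hf 1 0
  have h20 := hf 2 0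
  have h21 := hf 2 1
  fin_cases a <;> fin_cases b <;> simp <;> linarith

/-- A curvature tensor compatible with a Galilei metric that annihilates a timelike vector `u` is
determined by its Ricci tensor: the mixed components `R(u, v)w` are symmetric in `v, w` by the
Bianchi identity and skew in the last two indices by metricity, hence zero, and the purely spatial
part is a curvature tensor in dimension three. -/
theorem IsGalileiTriple.curvature_eq_zero (hT : IsGalileiTriple τ H u)
    (hE : Module.finrank ℝ E = 4) {R : E →ₗ[ℝ] E →ₗ[ℝ] E →ₗ[ℝ] E}
    (hskew : ∀ v w k, R v w k = -R w v k) (hu : ∀ v w, R v w u = 0)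
    (hτ : ∀ v w k, τ (R v w k) = 0)
    (hH : ∀ v w (α β : Module.Dual ℝ E), α (R v w (H β)) = -β (R v w (H α)))
    (hbianchi : ∀ v w k, R v w k + R w k v + R k v w = 0)
    (hric : ∀ w k, LinearMap.trace ℝ E ((R.flip w).flip k) = 0) : R = 0 := by
  obtain ⟨θ, -, -, hv⟩ := hT.exists_frame hE
  have hext : ∀ x : E, τ x = 0 → (∀ a, θ a x = 0) → x = 0 := fun x h0 h1 ↦ by
    rw [hv x]; simp [h0, h1]
  -- the Bianchi identity for `v, w, u`, where `R(v, w)u = 0`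
  have hs : ∀ v w, R u v w = R u w v := fun v w ↦ by
    have h := hbianchi u v w
    rw [hu, add_zero, hskew w u v, ← sub_eq_add_neg, sub_eq_zero] at h
    exact h
  -- `θ_c(R(u, e_a)e_b)` is symmetric in `a, b` and skew in `b, c`
  have hu1 : ∀ a b, R u (H (θ a)) (H (θ b)) = 0 := fun a b ↦ by
    refine hext _ (hτ _ _ _) fun c ↦ ?_
    have e1 := hH u (H (θ a)) (θ c) (θ b)
    have e2 := hH u (H (θ c)) (θ b) (θ a)
    have e3 := hH u (H (θ b)) (θ a) (θ c)
    rw [hs (H (θ a)) (H (θ c))] at e1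
    rw [hs (H (θ c)) (H (θ b))] at e2
    rw [hs (H (θ b)) (H (θ a))] at e3
    linarith
  have hru : ∀ v w, R u v w = 0 := fun v w ↦ by
    have huu : ∀ k, R u u k = 0 := fun k ↦ by
      refine hext _ (hτ _ _ _) fun c ↦ ?_
      have h := congrArg (θ c) (hskew u u k)
      rw [map_neg] at h
      linarith
    rw [hv v, hv w]
    simp [hu, huu, hu1, map_sum]
  -- the purely spatial components: in dimension three, six of them remain after the skew
  -- symmetries, and the six components of the Ricci tensor determine them
  have hspat : ∀ a b c d, θ d (R (H (θ a)) (H (θ b)) (H (θ c))) = 0 := by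
    have sk1 : ∀ c d a b, θ d (R (H (θ a)) (H (θ b)) (H (θ c))) =
        -θ d (R (H (θ b)) (H (θ a)) (H (θ c))) := fun c d a b ↦ by
      rw [hskew, map_neg]
    have sk2 : ∀ a b c d, θ d (R (H (θ a)) (H (θ b)) (H (θ c))) =
        -θ c (R (H (θ a)) (H (θ b)) (H (θ d))) := fun a b c d ↦ hH _ _ _ _
    have ric : ∀ b c, ∑ a, θ a (R (H (θ a)) (H (θ b)) (H (θ c))) = 0 := fun b c ↦ by
      have h := hric (H (θ b)) (H (θ c))
      rw [trace_eq_of_frame hv] at h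
      simpa [hru] using h
    simp only [Fin.sum_univ_three] at ric
    set r : Fin 3 → Fin 3 → Fin 3 → Fin 3 → ℝ :=
      fun a b c d ↦ θ d (R (H (θ a)) (H (θ b)) (H (θ c))) with hr
    change ∀ a b c d, r a b c d = 0
    change ∀ c d a b, r a b c d = -r b a c d at sk1
    change ∀ a b c d, r a b c d = -r a b d c at sk2
    change ∀ b c, r 0 b c 0 + r 1 b c 1 + r 2 b c 2 = 0 at ric
    have d1 : ∀ a c d, r a a c d = 0 := fun a c d ↦ by have := sk1 c d a a; linarith
    have d2 : ∀ a b c, r a b c c = 0 := fun a b c ↦ by have := sk2 a b c c; linarith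
    have red : ∀ c d, r 0 1 c d = 0 → r 0 2 c d = 0 → r 1 2 c d = 0 → ∀ a b, r a b c d = 0 :=
      fun c d h1 h2 h3 ↦ eq_zero_of_skew (sk1 c d) h1 h2 h3
    have e00 := ric 0 0
    have e11 := ric 1 1
    have e22 := ric 2 2
    have e01 := ric 0 1
    have e10 := ric 1 0
    have e02 := ric 0 2
    have e20 := ric 2 0
    have e12 := ric 1 2
    have e21 := ric 2 1
    simp only [d1, d2, zero_add, add_zero] at e00 e11 e22 e01 e10 e02 e20 e12 e21
    intro a b c d
    refine eq_zero_of_skew (sk2 a b) (red 0 1 ?_ ?_ ?_ a b) (red 0 2 ?_ ?_ ?_ a b)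
      (red 1 2 ?_ ?_ ?_ a b) c d <;>
    linarith [sk1 0 1 0 1, sk1 0 1 0 2, sk1 0 1 1 2, sk1 0 2 0 1, sk1 0 2 0 2, sk1 0 2 1 2,
      sk1 1 2 0 1, sk1 1 2 0 2, sk1 1 2 1 2, sk2 0 1 0 1, sk2 0 1 0 2, sk2 0 1 1 2,
      sk2 0 2 0 1, sk2 0 2 0 2, sk2 0 2 1 2, sk2 1 2 0 1, sk2 1 2 0 2, sk2 1 2 1 2,
      sk2 1 0 0 1, sk2 1 0 0 2, sk2 1 0 1 2, sk2 2 0 0 1, sk2 2 0 0 2, sk2 2 0 1 2,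
      sk2 2 1 0 1, sk2 2 1 0 2, sk2 2 1 1 2]
  ext v w k
  have hru' : ∀ v w, R v u w = 0 := fun v w ↦ by rw [hskew, hru, neg_zero]
  rw [hv v, hv w, hv k]
  have : ∀ a b c, R (H (θ a)) (H (θ b)) (H (θ c)) = 0 := fun a b c ↦
    hext _ (hτ _ _ _) fun d ↦ hspat a b c d
  simp [hu, hru, hru', this, map_sum]

end Pointwise

/-! ### Galilei connections on an open subset of a vector space -/

section Local

open Filter Topology

variable {E : Type*} [NormedAddCommGroup E] [NormedSpace ℝ E]

/-- The covariant derivative `v ↦ dY(v) + Γ(v, Y)` of a vector field on `E`, for the connection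
with Christoffel map `Γ`. -/
noncomputable def covDeriv (Γ : E → E →L[ℝ] E →L[ℝ] E) (Y : E → E) (z : E) : E →L[ℝ] E :=
  fderiv ℝ Y z + (Γ z).flip (Y z)

/-- The curvature `R(v, w)k = dΓ(v)(w, k) - dΓ(w)(v, k) + Γ(v, Γ(w, k)) - Γ(w, Γ(v, k))`. -/
noncomputable def christoffelCurvature (Γ : E → E →L[ℝ] E →L[ℝ] E) (z v w k : E) : E :=
  fderiv ℝ Γ z v w k - fderiv ℝ Γ z w v k + Γ z v (Γ z w k) - Γ z w (Γ z v k)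

/-- A symmetric Galilei connection on the open set `Ω`, given by its Christoffel map `Γ`, with
clock form `τ`, space metric `H` and a timelike unit field `u`. The equations `fderiv_τ` and
`fderiv_H` say that `τ` and `H` are parallel. -/
structure IsGalileiChart (Ω : Set E) (Γ : E → E →L[ℝ] E →L[ℝ] E) (τ : E → E →L[ℝ] ℝ)
    (H : E → (E →L[ℝ] ℝ) →L[ℝ] E) (u : E → E) : Prop where
  isOpen : IsOpen Ω
  smooth_Γ : ∀ z ∈ Ω, ContDiffAt ℝ ∞ Γ z
  smooth_τ : ∀ z ∈ Ω, ContDiffAt ℝ ∞ τ z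
  smooth_H : ∀ z ∈ Ω, ContDiffAt ℝ ∞ H z
  smooth_u : ∀ z ∈ Ω, ContDiffAt ℝ ∞ u z
  Γ_symm : ∀ z ∈ Ω, ∀ v w, Γ z v w = Γ z w v
  fderiv_τ : ∀ z ∈ Ω, ∀ v w, fderiv ℝ τ z v w = τ z (Γ z v w)
  fderiv_H : ∀ z ∈ Ω, ∀ (v : E) (α β : E →L[ℝ] ℝ),
    α (fderiv ℝ H z v β) = -α (Γ z v (H z β)) - β (Γ z v (H z α))
  symm : ∀ z ∈ Ω, ∀ α β : E →L[ℝ] ℝ, α (H z β) = β (H z α)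
  nonneg : ∀ z ∈ Ω, ∀ α : E →L[ℝ] ℝ, 0 ≤ α (H z α)
  apply_τ : ∀ z ∈ Ω, H z (τ z) = 0
  null : ∀ z ∈ Ω, ∀ α : E →L[ℝ] ℝ, α (H z α) = 0 → ∃ c : ℝ, α = c • τ z
  unit : ∀ z ∈ Ω, τ z (u z) = 1

variable {Ω : Set E} {Γ : E → E →L[ℝ] E →L[ℝ] E} {τ : E → E →L[ℝ] ℝ}
  {H : E → (E →L[ℝ] ℝ) →L[ℝ] E} {u : E → E} {z : E}

theorem contDiffAt_flip (hΓ : ContDiffAt ℝ ∞ Γ z) : ContDiffAt ℝ ∞ (fun z ↦ (Γ z).flip) z :=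
  (ContinuousLinearMap.flipₗᵢ ℝ E E E).contDiff.contDiffAt.comp z hΓ

theorem contDiffAt_covDeriv {Y : E → E} (hΓ : ContDiffAt ℝ ∞ Γ z) (hY : ContDiffAt ℝ ∞ Y z) :
    ContDiffAt ℝ ∞ (covDeriv Γ Y) z := by
  have h1 : ContDiffAt ℝ ∞ (fderiv ℝ Y) z := hY.fderiv_right le_rfl
  exact h1.add ((contDiffAt_flip hΓ).clm_apply hY)

theorem covDeriv_apply (Y : E → E) (v : E) :
    covDeriv Γ Y z v = fderiv ℝ Y z v + Γ z v (Y z) := by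
  simp [covDeriv]

theorem hasFDerivAt_of_smooth {F : Type*} [NormedAddCommGroup F] [NormedSpace ℝ F]
    {f : E → F} (hf : ContDiffAt ℝ ∞ f z) : HasFDerivAt f (fderiv ℝ f z) z :=
  (hf.differentiableAt (by simp)).hasFDerivAt

theorem fderiv_fderiv_symm {F : Type*} [NormedAddCommGroup F] [NormedSpace ℝ F]
    {f : E → F} (hf : ContDiffAt ℝ ∞ f z) (v w : E) :
    fderiv ℝ (fderiv ℝ f) z v w = fderiv ℝ (fderiv ℝ f) z w v :=
  (hf.isSymmSndFDerivAt (by simpa using WithTop.coe_le_coe.2 (le_top (a := (2 : ℕ∞))))).eq v w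

/-- The Ricci identity: `R(v, w)Y` is the antisymmetrised covariant derivative of `∇Y`. -/
theorem christoffelCurvature_apply {Y : E → E} (hΓ : ContDiffAt ℝ ∞ Γ z)
    (hY : ContDiffAt ℝ ∞ Y z) (v w : E) :
    christoffelCurvature Γ z v w (Y z) =
      fderiv ℝ (covDeriv Γ Y) z v w - fderiv ℝ (covDeriv Γ Y) z w v
        + Γ z v (covDeriv Γ Y z w) - Γ z w (covDeriv Γ Y z v) := by
  have key : ∀ v w, fderiv ℝ (covDeriv Γ Y) z v w =
      fderiv ℝ (fderiv ℝ Y) z v w + fderiv ℝ Γ z v w (Y z) + Γ z w (fderiv ℝ Y z v) := by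
    intro v w
    have h1 : HasFDerivAt (fderiv ℝ Y) (fderiv ℝ (fderiv ℝ Y) z) z :=
      hasFDerivAt_of_smooth (hY.fderiv_right (m := ∞) le_rfl)
    have h2 := hasFDerivAt_of_smooth hΓ
    have h3 := hasFDerivAt_of_smooth hY
    have h4 := hasFDerivAt_of_smooth (contDiffAt_covDeriv hΓ hY)
    have h5 := h4.clm_apply (hasFDerivAt_const w z)
    have h6 := (h1.clm_apply (hasFDerivAt_const w z)).add
      ((h2.clm_apply (hasFDerivAt_const w z)).clm_apply h3)
    have h7 : (fun z ↦ covDeriv Γ Y z w) =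
        (fun z ↦ fderiv ℝ Y z w) + (fun z ↦ Γ z w (Y z)) := by
      ext z; simp [covDeriv_apply]
    have h5' : HasFDerivAt (fun z ↦ covDeriv Γ Y z w) _ z := h5
    rw [h7] at h5'
    have h8 := congrArg (fun L : E →L[ℝ] E ↦ L v) (h5'.unique h6)
    simp only [_root_.add_apply, ContinuousLinearMap.comp_apply,
      _root_.zero_apply, map_zero, zero_add, ContinuousLinearMap.flip_apply] at h8
    rw [h8]
    abel
  rw [key, key, fderiv_fderiv_symm hY v w, christoffelCurvature]
  simp only [covDeriv_apply, map_add]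
  abel

variable (hC : IsGalileiChart Ω Γ τ H u) (hz : z ∈ Ω)

namespace IsGalileiChart

include hC hz

theorem eventually_mem : ∀ᶠ y in 𝓝 z, y ∈ Ω := hC.isOpen.mem_nhds hz

theorem τ_covDeriv (v : E) : τ z (covDeriv Γ u z v) = 0 := by
  have h1 := (hasFDerivAt_of_smooth (hC.smooth_τ z hz)).clm_apply
    (hasFDerivAt_of_smooth (hC.smooth_u z hz))
  have h2 : (fun y ↦ τ y (u y)) =ᶠ[𝓝 z] fun _ ↦ 1 := by
    filter_upwards [hC.eventually_mem hz] with y hy using hC.unit y hy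
  have h3 := congrArg (fun L : E →L[ℝ] ℝ ↦ L v)
    (h1.unique ((hasFDerivAt_const (1 : ℝ) z).congr_of_eventuallyEq h2))
  simp only [_root_.add_apply, ContinuousLinearMap.comp_apply,
    ContinuousLinearMap.flip_apply, hC.fderiv_τ z hz, _root_.zero_apply] at h3
  rw [covDeriv_apply, map_add, h3]

set_option synthInstance.maxHeartbeats 200000 in
theorem τ_curvature (v w k : E) : τ z (christoffelCurvature Γ z v w k) = 0 := by
  have hf : ContDiffAt ℝ ∞ (fun y ↦ τ y k) z := (hC.smooth_τ z hz).clm_apply contDiffAt_const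
  have key : ∀ v w, fderiv ℝ (fderiv ℝ fun y ↦ τ y k) z v w =
      τ z (Γ z v (Γ z w k)) + τ z (fderiv ℝ Γ z v w k) := by
    intro v w
    have h2 := (hasFDerivAt_of_smooth (hf.fderiv_right (m := ∞) le_rfl)).clm_apply
      (hasFDerivAt_const w z)
    have h3 := (hasFDerivAt_of_smooth (hC.smooth_τ z hz)).clm_apply
      (((hasFDerivAt_of_smooth (hC.smooth_Γ z hz)).clm_apply
        (hasFDerivAt_const w z)).clm_apply (hasFDerivAt_const k z))
    have h4 : (fun y ↦ fderiv ℝ (fun y ↦ τ y k) y w) =ᶠ[𝓝 z] fun y ↦ τ y (Γ y w k) := by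
      filter_upwards [hC.eventually_mem hz] with y hy
      rw [← hC.fderiv_τ y hy w k, ((hasFDerivAt_of_smooth (hC.smooth_τ y hy)).clm_apply
        (hasFDerivAt_const k y)).fderiv]
      simp
    have h5 := congrArg (fun L : E →L[ℝ] ℝ ↦ L v) (h2.unique (h3.congr_of_eventuallyEq h4))
    simp only [_root_.add_apply, ContinuousLinearMap.comp_apply,
      ContinuousLinearMap.flip_apply, _root_.zero_apply, map_zero, zero_add] at h5
    rw [h5, hC.fderiv_τ z hz]
    abel
  have h := fderiv_fderiv_symm hf v w
  simp only [key] at h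
  simp only [christoffelCurvature, map_add, map_sub]
  linarith

set_option synthInstance.maxHeartbeats 200000 in
theorem H_curvature (v w : E) (α β : E →L[ℝ] ℝ) :
    α (christoffelCurvature Γ z v w (H z β)) = -β (christoffelCurvature Γ z v w (H z α)) := by
  have hΓ := (hasFDerivAt_of_smooth (hC.smooth_Γ z hz))
  have hH := (hasFDerivAt_of_smooth (hC.smooth_H z hz))
  have hd : ∀ (w : E) (α β : E →L[ℝ] ℝ), HasFDerivAt (fun y ↦ α (Γ y w (H y β)))
      (α.comp ((Γ z w).comp ((fderiv ℝ H z).flip β) + ((fderiv ℝ Γ z).flip w).flip (H z β))) z := by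
    intro w α β
    have h1 := (hΓ.clm_apply (hasFDerivAt_const w z)).clm_apply
      (hH.clm_apply (hasFDerivAt_const β z))
    refine (α.hasFDerivAt.comp z h1).congr_fderiv ?_
    ext x
    simp
  have hf : ContDiffAt ℝ ∞ (fun y ↦ α (H y β)) z :=
    α.contDiff.contDiffAt.comp z ((hC.smooth_H z hz).clm_apply contDiffAt_const)
  have key : ∀ v w, fderiv ℝ (fderiv ℝ fun y ↦ α (H y β)) z v w =
      -(α (Γ z w (fderiv ℝ H z v β)) + α (fderiv ℝ Γ z v w (H z β)))
        - (β (Γ z w (fderiv ℝ H z v α)) + β (fderiv ℝ Γ z v w (H z α))) := by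
    intro v w
    have h2 := (hasFDerivAt_of_smooth (hf.fderiv_right (m := ∞) le_rfl)).clm_apply
      (hasFDerivAt_const w z)
    have h3 := (hd w α β).neg.sub (hd w β α)
    have h4 : (fun y ↦ fderiv ℝ (fun y ↦ α (H y β)) y w) =ᶠ[𝓝 z]
        fun y ↦ -α (Γ y w (H y β)) - β (Γ y w (H y α)) := by
      filter_upwards [hC.eventually_mem hz] with y hy
      have h := α.hasFDerivAt.comp y ((hasFDerivAt_of_smooth (hC.smooth_H y hy)).clm_apply
        (hasFDerivAt_const β y))
      rw [← hC.fderiv_H y hy w α β, show (fun y ↦ α (H y β)) = α ∘ fun y ↦ H y β from rfl, h.fderiv]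
      simp
    have h5 := congrArg (fun L : E →L[ℝ] ℝ ↦ L v) (h2.unique (h3.congr_of_eventuallyEq h4))
    simpa using h5
  have cross : ∀ (v w : E) (α β : E →L[ℝ] ℝ), α (Γ z w (fderiv ℝ H z v β)) =
      -α (Γ z w (Γ z v (H z β))) - β (Γ z v (H z (α.comp (Γ z w)))) := fun v w α β ↦
    hC.fderiv_H z hz v (α.comp (Γ z w)) β
  have sw : ∀ v w, α (Γ z v (H z (β.comp (Γ z w)))) = β (Γ z w (H z (α.comp (Γ z v)))) :=
    fun v w ↦ hC.symm z hz (α.comp (Γ z v)) (β.comp (Γ z w))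
  have h := fderiv_fderiv_symm hf v w
  simp only [key, cross] at h
  have s1 := sw v w
  have s2 := sw w v
  simp only [christoffelCurvature, map_add, map_sub]
  linarith

/-- The data of the chart at a point form a Galilei triple. -/
theorem isGalileiTriple [FiniteDimensional ℝ E] : IsGalileiTriple (τ z : E →ₗ[ℝ] ℝ)
    ((H z : (E →L[ℝ] ℝ) →ₗ[ℝ] E) ∘ₗ
      (LinearMap.toContinuousLinearMap : (E →ₗ[ℝ] ℝ) ≃ₗ[ℝ] (E →L[ℝ] ℝ)).toLinearMap) (u z) where
  symm α β := hC.symm z hz (LinearMap.toContinuousLinearMap α) (LinearMap.toContinuousLinearMap β)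
  nonneg α := hC.nonneg z hz (LinearMap.toContinuousLinearMap α)
  apply_τ := by
    have : LinearMap.toContinuousLinearMap (τ z : E →ₗ[ℝ] ℝ) = τ z := by ext; rfl
    simp [this, hC.apply_τ z hz]
  null α h := by
    obtain ⟨c, hc⟩ := hC.null z hz (LinearMap.toContinuousLinearMap α) h
    refine ⟨c, ?_⟩
    ext v
    exact congrArg (fun L : E →L[ℝ] ℝ ↦ L v) hc
  unit := hC.unit z hz

end IsGalileiChart

end Local

/-! ### Kinematics of a geodesic field without vorticity -/

section LocalDynamics

open Filter Topology

variable {E : Type*} [NormedAddCommGroup E] [NormedSpace ℝ E]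

theorem christoffelCurvature_swap (Γ : E → E →L[ℝ] E →L[ℝ] E) (z v w k : E) :
    christoffelCurvature Γ z v w k = -christoffelCurvature Γ z w v k := by
  simp only [christoffelCurvature]
  abel

set_option synthInstance.maxHeartbeats 200000 in
theorem christoffelCurvature_add_left (Γ : E → E →L[ℝ] E →L[ℝ] E) (z v v' w k : E) :
    christoffelCurvature Γ z (v + v') w k =
      christoffelCurvature Γ z v w k + christoffelCurvature Γ z v' w k := by
  simp only [christoffelCurvature, map_add, _root_.add_apply]
  abel

theorem christoffelCurvature_smul_left (Γ : E → E →L[ℝ] E →L[ℝ] E) (z : E) (c : ℝ) (v w k : E) :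
    christoffelCurvature Γ z (c • v) w k = c • christoffelCurvature Γ z v w k := by
  have h : ∀ L : E →L[ℝ] E →L[ℝ] E, L (c • v) = c • L v := fun L ↦ L.map_smul c v
  have h' : ∀ L : E →L[ℝ] E →L[ℝ] E →L[ℝ] E, L (c • v) = c • L v := fun L ↦ L.map_smul c v
  simp only [christoffelCurvature, h, smul_sub, smul_add]
  rw [h']
  simp only [_root_.smul_apply, (Γ z w).map_smul]

set_option synthInstance.maxHeartbeats 200000 in
/-- `christoffelCurvature` as a trilinear map. -/
noncomputable def christoffelCurvatureₗ (Γ : E → E →L[ℝ] E →L[ℝ] E) (z : E) :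
    E →ₗ[ℝ] E →ₗ[ℝ] E →ₗ[ℝ] E :=
  LinearMap.mk₂ ℝ (fun v w ↦
      { toFun := christoffelCurvature Γ z v w
        map_add' := fun _ _ ↦ by simp only [christoffelCurvature, map_add]; abel
        map_smul' := fun _ _ ↦ by
          simp only [christoffelCurvature, map_smul, smul_sub, smul_add, RingHom.id_apply] })
    (fun v v' w ↦ LinearMap.ext fun k ↦ christoffelCurvature_add_left Γ z v v' w k)
    (fun c v w ↦ LinearMap.ext fun k ↦ christoffelCurvature_smul_left Γ z c v w k)
    (fun v w w' ↦ LinearMap.ext fun k ↦ by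
      change christoffelCurvature Γ z v (w + w') k =
        christoffelCurvature Γ z v w k + christoffelCurvature Γ z v w' k
      rw [christoffelCurvature_swap, christoffelCurvature_add_left, neg_add,
        ← christoffelCurvature_swap, ← christoffelCurvature_swap])
    (fun c v w ↦ LinearMap.ext fun k ↦ by
      change christoffelCurvature Γ z v (c • w) k = c • christoffelCurvature Γ z v w k
      rw [christoffelCurvature_swap, christoffelCurvature_smul_left, ← smul_neg,
        ← christoffelCurvature_swap])

variable {Ω : Set E} {Γ : E → E →L[ℝ] E →L[ℝ] E} {τ : E → E →L[ℝ] ℝ}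
  {H : E → (E →L[ℝ] ℝ) →L[ℝ] E} {u : E → E} {z : E}

theorem christoffelCurvatureₗ_apply (v w k : E) :
    christoffelCurvatureₗ Γ z v w k = christoffelCurvature Γ z v w k := rfl

/-- The derivative of `A u = 0` for `A = ∇u`: `dA(v) u = -A(du(v))`. -/
theorem fderiv_covDeriv_apply_self (hΓ : ContDiffAt ℝ ∞ Γ z) (hu : ContDiffAt ℝ ∞ u z)
    (ha : ∀ᶠ y in 𝓝 z, covDeriv Γ u y (u y) = 0) (v : E) :
    fderiv ℝ (covDeriv Γ u) z v (u z) = -covDeriv Γ u z (fderiv ℝ u z v) := by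
  have h1 := (hasFDerivAt_of_smooth (contDiffAt_covDeriv hΓ hu)).clm_apply
    (hasFDerivAt_of_smooth hu)
  have h2 := congrArg (fun L : E →L[ℝ] E ↦ L v)
    (h1.unique ((hasFDerivAt_const (0 : E) z).congr_of_eventuallyEq ha))
  simp only [_root_.add_apply, ContinuousLinearMap.comp_apply,
    ContinuousLinearMap.flip_apply, _root_.zero_apply] at h2
  exact eq_neg_of_add_eq_zero_right h2

/-- The Lie derivative of the strain `Θ = ∇u ∘ H` of a vorticity-free field `u`, evaluated on
covectors: `L_u Θ = (∇_u A - 2 A²) ∘ H` with `A = ∇u`. -/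
theorem IsGalileiChart.lie_strain (hC : IsGalileiChart Ω Γ τ H u) (hz : z ∈ Ω)
    (hΩ : ∀ y ∈ Ω, ∀ α β : E →L[ℝ] ℝ,
      α (covDeriv Γ u y (H y β)) = β (covDeriv Γ u y (H y α))) (α β : E →L[ℝ] ℝ) :
    α (fderiv ℝ (fun y ↦ covDeriv Γ u y (H y β)) z (u z)
        - fderiv ℝ u z (covDeriv Γ u z (H z β)))
      + β (fderiv ℝ (fun y ↦ covDeriv Γ u y (H y α)) z (u z)
        - fderiv ℝ u z (covDeriv Γ u z (H z α)))
      - fderiv ℝ (fun y ↦ α (covDeriv Γ u y (H y β))) z (u z) =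
    α (fderiv ℝ (covDeriv Γ u) z (u z) (H z β) + Γ z (u z) (covDeriv Γ u z (H z β))
      - covDeriv Γ u z (Γ z (u z) (H z β))
      - (2 : ℝ) • covDeriv Γ u z (covDeriv Γ u z (H z β))) := by
  have hdA := hasFDerivAt_of_smooth
    (contDiffAt_covDeriv (hC.smooth_Γ z hz) (hC.smooth_u z hz))
  have hdH := hasFDerivAt_of_smooth (hC.smooth_H z hz)
  have hd : ∀ β : E →L[ℝ] ℝ, HasFDerivAt (fun y ↦ covDeriv Γ u y (H y β)) _ z := fun β ↦
    hdA.clm_apply (hdH.clm_apply (hasFDerivAt_const β z))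
  have e1 : ∀ β : E →L[ℝ] ℝ, fderiv ℝ (fun y ↦ covDeriv Γ u y (H y β)) z (u z) =
      covDeriv Γ u z (fderiv ℝ H z (u z) β) + fderiv ℝ (covDeriv Γ u) z (u z) (H z β) := fun β ↦ by
    rw [(hd β).fderiv]
    simp
  have e2 : fderiv ℝ (fun y ↦ α (covDeriv Γ u y (H y β))) z (u z) =
      β (fderiv ℝ (fun y ↦ covDeriv Γ u y (H y α)) z (u z)) := by
    have h1 : (fun y ↦ α (covDeriv Γ u y (H y β))) =ᶠ[𝓝 z]
        β ∘ fun y ↦ covDeriv Γ u y (H y α) := by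
      filter_upwards [hC.eventually_mem hz] with y hy using hΩ y hy α β
    rw [h1.fderiv_eq, (β.hasFDerivAt.comp z (hd α)).fderiv, (hd α).fderiv]
    rfl
  have hdu : ∀ v, fderiv ℝ u z v = covDeriv Γ u z v - Γ z (u z) v := fun v ↦ by
    rw [covDeriv_apply, hC.Γ_symm z hz v]; abel
  set A := covDeriv Γ u z with hA
  -- `A` is `H`-symmetric, which moves `A` from one covector to the other
  have hsymm : ∀ α β : E →L[ℝ] ℝ, α (A (H z β)) = β (A (H z α)) := hΩ z hz
  have hAH : ∀ β : E →L[ℝ] ℝ, ∀ α : E →L[ℝ] ℝ, α (A (H z β)) = α (H z (β.comp A)) := fun β α ↦ by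
    rw [hsymm, hC.symm z hz α]; rfl
  have h1 := hC.fderiv_H z hz (u z) (α.comp A) β
  have h2 : β (A (A (H z α))) = α (A (A (H z β))) := by
    have h3 := hsymm (β.comp A) α
    have h4 := hAH β (α.comp A)
    simp only [ContinuousLinearMap.comp_apply] at h3 h4
    rw [h3, h4]
  have h5 : β (Γ z (u z) (H z (α.comp A))) = β (Γ z (u z) (A (H z α))) :=
    (hAH α (β.comp (Γ z (u z)))).symm
  rw [e2, e1]
  simp only [hdu, map_sub, map_add, map_smul, smul_eq_mul]
  simp only [ContinuousLinearMap.comp_apply] at h1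
  rw [h1, h2, h5]
  ring

variable [FiniteDimensional ℝ E]

/-- The trace as a continuous linear functional. -/
noncomputable def traceL (E : Type*) [NormedAddCommGroup E] [NormedSpace ℝ E]
    [FiniteDimensional ℝ E] : (E →L[ℝ] E) →L[ℝ] ℝ :=
  LinearMap.toContinuousLinearMap
    (LinearMap.trace ℝ E ∘ₗ ContinuousLinearMap.coeLM ℝ)

theorem traceL_apply (A : E →L[ℝ] E) : traceL E A = LinearMap.trace ℝ E (A : E →ₗ[ℝ] E) := rfl

theorem traceL_comp_comm (A B : E →L[ℝ] E) : traceL E (A.comp B) = traceL E (B.comp A) :=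
  LinearMap.trace_mul_comm ℝ (A : E →ₗ[ℝ] E) (B : E →ₗ[ℝ] E)

theorem fderiv_traceL_covDeriv (hΓ : ContDiffAt ℝ ∞ Γ z) (hu : ContDiffAt ℝ ∞ u z) (v : E) :
    fderiv ℝ (fun y ↦ traceL E (covDeriv Γ u y)) z v =
      traceL E (fderiv ℝ (covDeriv Γ u) z v) := by
  have h := (traceL E).hasFDerivAt.comp z (hasFDerivAt_of_smooth (contDiffAt_covDeriv hΓ hu))
  rw [show (fun y ↦ traceL E (covDeriv Γ u y)) = traceL E ∘ covDeriv Γ u from rfl, h.fderiv]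
  rfl

/-- The Raychaudhuri equation `Ric(u, u) = -u(θ) - tr (∇u)²` of a geodesic field `u`. -/
theorem trace_christoffelCurvature_self (hΓ : ContDiffAt ℝ ∞ Γ z)
    (hsymm : ∀ v w, Γ z v w = Γ z w v) (hu : ContDiffAt ℝ ∞ u z)
    (ha : ∀ᶠ y in 𝓝 z, covDeriv Γ u y (u y) = 0) :
    LinearMap.trace ℝ E (((christoffelCurvatureₗ Γ z).flip (u z)).flip (u z)) =
      -fderiv ℝ (fun y ↦ traceL E (covDeriv Γ u y)) z (u z)
        - traceL E ((covDeriv Γ u z).comp (covDeriv Γ u z)) := by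
  set A := covDeriv Γ u z with hA
  have h0 : A (u z) = 0 := ha.self_of_nhds
  have key : ((christoffelCurvatureₗ Γ z).flip (u z)).flip (u z) =
      ((A.comp (Γ z (u z)) - (Γ z (u z)).comp A - A.comp A
        - fderiv ℝ (covDeriv Γ u) z (u z) : E →L[ℝ] E) : E →ₗ[ℝ] E) := by
    ext v
    have h1 := christoffelCurvature_apply hΓ hu v (u z)
    rw [fderiv_covDeriv_apply_self hΓ hu ha, ← hA, h0, map_zero, add_zero] at h1
    have h2 : A v = fderiv ℝ u z v + Γ z v (u z) := covDeriv_apply u v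
    have h3 : fderiv ℝ u z v = A v - Γ z (u z) v := by rw [h2, hsymm v (u z)]; abel
    rw [h3, map_sub] at h1
    change christoffelCurvature Γ z v (u z) (u z) = _
    rw [h1]
    simp
    abel
  rw [key, ← traceL_apply, fderiv_traceL_covDeriv hΓ hu]
  simp only [map_sub]
  rw [traceL_comp_comm A (Γ z (u z))]
  ring

namespace IsGalileiChart

variable (hC : IsGalileiChart Ω Γ τ H u) (hz : z ∈ Ω)

include hC hz

theorem covDeriv_comp_H (hΩ : ∀ α β : E →L[ℝ] ℝ,
      α (covDeriv Γ u z (H z β)) = β (covDeriv Γ u z (H z α))) (hE : Module.finrank ℝ E = 4)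
    (hu : covDeriv Γ u z (u z) = 0) :
    0 ≤ traceL E ((covDeriv Γ u z).comp (covDeriv Γ u z)) ∧
      (traceL E ((covDeriv Γ u z).comp (covDeriv Γ u z)) = 0 → covDeriv Γ u z = 0) := by
  have h := (hC.isGalileiTriple hz).trace_sq_nonneg hE
    (A := (covDeriv Γ u z : E →ₗ[ℝ] E)) (hC.τ_covDeriv hz) hu
    fun α β ↦ hΩ (LinearMap.toContinuousLinearMap α) (LinearMap.toContinuousLinearMap β)
  refine ⟨h.1, fun h0 ↦ ?_⟩
  ext v
  exact LinearMap.congr_fun (h.2 h0) v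

/-- A geodesic vorticity-free field with stationary strain and expansion is parallel: its
covariant derivative `A` satisfies `∇_u A = 2 A²`, whose trace is `u(θ) = 2 tr A²`. -/
theorem covDeriv_eq_zero_of_static (hE : Module.finrank ℝ E = 4)
    (ha : ∀ᶠ y in 𝓝 z, covDeriv Γ u y (u y) = 0)
    (hΩ : ∀ α β : E →L[ℝ] ℝ, α (covDeriv Γ u z (H z β)) = β (covDeriv Γ u z (H z α)))
    (hθ : fderiv ℝ (fun y ↦ traceL E (covDeriv Γ u y)) z (u z) = 0)
    (hΘ : ∀ α β : E →L[ℝ] ℝ,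
      α (fderiv ℝ (covDeriv Γ u) z (u z) (H z β) + Γ z (u z) (covDeriv Γ u z (H z β))
        - covDeriv Γ u z (Γ z (u z) (H z β))
        - (2 : ℝ) • covDeriv Γ u z (covDeriv Γ u z (H z β))) = 0) :
    covDeriv Γ u z = 0 := by
  have h0 : covDeriv Γ u z (u z) = 0 := ha.self_of_nhds
  have hΓ := hC.smooth_Γ z hz
  have hu := hC.smooth_u z hz
  refine (hC.covDeriv_comp_H hz hΩ hE h0).2 ?_
  rw [fderiv_traceL_covDeriv hΓ hu] at hθ
  have hd := fderiv_covDeriv_apply_self hΓ hu ha (u z)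
  have hdu : fderiv ℝ u z (u z) = -Γ z (u z) (u z) := by
    rw [covDeriv_apply] at h0
    exact eq_neg_of_add_eq_zero_left h0
  rw [hdu, map_neg, neg_neg] at hd
  set A := covDeriv Γ u z with hA
  set B := fderiv ℝ (covDeriv Γ u) z (u z) with hB
  have key : ((B + (Γ z (u z)).comp A - A.comp (Γ z (u z)) : E →L[ℝ] E) : E →ₗ[ℝ] E) =
      (((2 : ℝ) • A.comp A : E →L[ℝ] E) : E →ₗ[ℝ] E) := by
    refine (hC.isGalileiTriple hz).ext_linearMap hE ?_ fun β ↦ ?_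
    · simp [h0, hd]
    · rw [← sub_eq_zero]
      refine (Module.forall_dual_apply_eq_zero_iff ℝ _).1 fun α ↦ ?_
      exact hΘ (LinearMap.toContinuousLinearMap α) (LinearMap.toContinuousLinearMap β)
  have htr := congrArg (LinearMap.trace ℝ E) key
  rw [← traceL_apply, ← traceL_apply] at htr
  simp only [map_add, map_sub, map_smul, smul_eq_mul, hθ] at htr
  rw [traceL_comp_comm A (Γ z (u z))] at htr
  linarith

set_option synthInstance.maxHeartbeats 200000 in
/-- A Ricci-flat Galilei connection with a parallel timelike unit field is flat. -/
theorem christoffelCurvature_eq_zero (hE : Module.finrank ℝ E = 4)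
    (hA : ∀ᶠ y in 𝓝 z, covDeriv Γ u y = 0)
    (hric : ∀ w k, LinearMap.trace ℝ E (((christoffelCurvatureₗ Γ z).flip w).flip k) = 0)
    (v w k : E) : christoffelCurvature Γ z v w k = 0 := by
  have hΓ := hC.smooth_Γ z hz
  have hu := hC.smooth_u z hz
  have hA0 : fderiv ℝ (covDeriv Γ u) z = 0 := by
    have h : covDeriv Γ u =ᶠ[𝓝 z] fun _ ↦ 0 := hA
    rw [h.fderiv_eq]
    simp
  have hdsymm : ∀ v w k, fderiv ℝ Γ z v w k = fderiv ℝ Γ z v k w := fun v w k ↦ by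
    have h1 := ((hasFDerivAt_of_smooth hΓ).clm_apply (hasFDerivAt_const w z)).clm_apply
      (hasFDerivAt_const k z)
    have h2 := ((hasFDerivAt_of_smooth hΓ).clm_apply (hasFDerivAt_const k z)).clm_apply
      (hasFDerivAt_const w z)
    have h3 : (fun y ↦ Γ y w k) =ᶠ[𝓝 z] fun y ↦ Γ y k w := by
      filter_upwards [hC.eventually_mem hz] with y hy using hC.Γ_symm y hy w k
    simpa using congrArg (fun L : E →L[ℝ] E ↦ L v) (h1.unique (h2.congr_of_eventuallyEq h3))
  have hR : christoffelCurvatureₗ Γ z = 0 := by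
    refine (hC.isGalileiTriple hz).curvature_eq_zero hE (fun v w k ↦ ?_) (fun v w ↦ ?_)
      (hC.τ_curvature hz) (fun v w α β ↦ ?_) (fun v w k ↦ ?_) hric
    · exact christoffelCurvature_swap Γ z v w k
    · have h := christoffelCurvature_apply hΓ hu v w
      rw [hA0, hA.self_of_nhds] at h
      rw [christoffelCurvatureₗ_apply, h]
      simp
    · exact hC.H_curvature hz v w (LinearMap.toContinuousLinearMap α)
        (LinearMap.toContinuousLinearMap β)
    · simp only [christoffelCurvatureₗ_apply, christoffelCurvature]
      rw [hdsymm v k w, hdsymm w v k, hdsymm k w v, hC.Γ_symm z hz v k, hC.Γ_symm z hz w v,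
        hC.Γ_symm z hz k w]
      abel
  rw [← christoffelCurvatureₗ_apply, hR]
  rfl

end IsGalileiChart

end LocalDynamics

/-! ### Representatives of fields in a chart -/

section Representatives

open Filter Topology

variable {M : Type*} [TopologicalSpace M] [ChartedSpace R4 M]

theorem chart_left_inv {x y : M} (hy : y ∈ (chartAt R4 x).source) :
    (extChartAt (𝓡 4) x).symm (extChartAt (𝓡 4) x y) = y :=
  (extChartAt (𝓡 4) x).left_inv (by rwa [extChartAt_source])

variable [IsManifold (𝓡 4) ∞ M]

/-- The identification `T_y M → ℝ⁴` given by the chart at `x`, for `y` in its domain. Elsewhere it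
is a junk value. -/
noncomputable def toChart (x y : M) : TSpace M y →L[ℝ] R4 :=
  (trivializationAt R4 (TSpace M) x).continuousLinearMapAt ℝ y

/-- The inverse `ℝ⁴ → T_y M` of `toChart`, again for `y` in the domain of the chart at `x`. -/
noncomputable def ofChart (x y : M) : R4 →L[ℝ] TSpace M y :=
  (trivializationAt R4 (TSpace M) x).symmL ℝ y

/-- The chart representative of a vector field. -/
noncomputable def vecRep (x : M) (Y : Π y : M, TSpace M y) (z : R4) : R4 :=
  toChart x ((extChartAt (𝓡 4) x).symm z) (Y ((extChartAt (𝓡 4) x).symm z))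

/-- The chart representative of a one-form. -/
noncomputable def formRep (x : M) (α : Π y : M, CSpace M y) (z : R4) : R4 →L[ℝ] ℝ :=
  (α ((extChartAt (𝓡 4) x).symm z)).comp (ofChart x ((extChartAt (𝓡 4) x).symm z))

/-- The chart representative of a field of endomorphisms. -/
noncomputable def endRep (x : M) (A : Π y : M, TSpace M y →L[ℝ] TSpace M y) (z : R4) :
    R4 →L[ℝ] R4 :=
  ((toChart x ((extChartAt (𝓡 4) x).symm z)).comp (A ((extChartAt (𝓡 4) x).symm z))).comp
    (ofChart x ((extChartAt (𝓡 4) x).symm z))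

/-- The chart representative of a contravariant tensor field of rank two, given by maps
`T_y^* M → T_y M`. A covector `β` on `ℝ⁴` is pulled back to `T_y M` along `toChart`. -/
noncomputable def sharpRep (x : M) (S : Π y : M, CSpace M y →L[ℝ] TSpace M y) (z : R4) :
    (R4 →L[ℝ] ℝ) →L[ℝ] R4 :=
  ((toChart x ((extChartAt (𝓡 4) x).symm z)).comp (S ((extChartAt (𝓡 4) x).symm z))).comp
    (ContinuousLinearMap.precomp ℝ (toChart x ((extChartAt (𝓡 4) x).symm z)))

variable {x y : M}

theorem toChart_ofChart (hy : y ∈ (chartAt R4 x).source) (v : R4) :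
    toChart x y (ofChart x y v) = v :=
  (trivializationAt R4 (TSpace M) x).continuousLinearMapAt_symmL hy v

theorem ofChart_toChart (hy : y ∈ (chartAt R4 x).source) (v : TSpace M y) :
    ofChart x y (toChart x y v) = v :=
  (trivializationAt R4 (TSpace M) x).symmL_continuousLinearMapAt hy v

theorem trivializationAt_apply_eq_toChart (hy : y ∈ (chartAt R4 x).source) (v : TSpace M y) :
    (trivializationAt R4 (TSpace M) x ⟨y, v⟩).2 = toChart x y v := by
  rw [toChart, Bundle.Trivialization.continuousLinearMapAt_apply,
    Bundle.Trivialization.coe_linearMapAt_of_mem _ hy]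

theorem toChart_self (x : M) : toChart x x = ContinuousLinearMap.id ℝ R4 := by
  have h := TangentBundle.continuousLinearMapAt_trivializationAt (I := 𝓡 4)
    (mem_chart_source R4 x)
  rw [mfderiv_extChartAt_self] at h
  exact h

theorem contMDiffAt_chart_symm (hy : y ∈ (chartAt R4 x).source) :
    ContMDiffAt 𝓘(ℝ, R4) (𝓡 4) ∞ (extChartAt (𝓡 4) x).symm (extChartAt (𝓡 4) x y) := by
  have h : extChartAt (𝓡 4) x y ∈ (extChartAt (𝓡 4) x).target :=
    (extChartAt (𝓡 4) x).map_source (by rwa [extChartAt_source])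
  exact (contMDiffOn_extChartAt_symm x).contMDiffAt ((isOpen_extChartAt_target x).mem_nhds h)

theorem contDiffAt_rep {F : Type*} [NormedAddCommGroup F] [NormedSpace ℝ F] {f : M → F}
    (hy : y ∈ (chartAt R4 x).source) (hf : ContMDiffAt (𝓡 4) 𝓘(ℝ, F) ∞ f y) :
    ContDiffAt ℝ ∞ (f ∘ (extChartAt (𝓡 4) x).symm) (extChartAt (𝓡 4) x y) := by
  rw [← contMDiffAt_iff_contDiffAt]
  refine ContMDiffAt.comp _ ?_ (contMDiffAt_chart_symm hy)
  rwa [chart_left_inv hy]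

theorem contDiffAt_vecRep (hy : y ∈ (chartAt R4 x).source) {Y : Π y : M, TSpace M y}
    (hY : ContMDiffAt (𝓡 4) ((𝓡 4).prod 𝓘(ℝ, R4)) ∞
      (fun x ↦ (⟨x, Y x⟩ : Bundle.TotalSpace R4 (TSpace M))) y) :
    ContDiffAt ℝ ∞ (vecRep x Y) (extChartAt (𝓡 4) x y) := by
  have h := ((trivializationAt R4 (TSpace M) x).contMDiffAt_section_iff hy).1 hY
  refine (contDiffAt_rep hy h).congr_of_eventuallyEq ?_
  filter_upwards [(isOpen_extChartAt_target x).mem_nhds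
    ((extChartAt (𝓡 4) x).map_source (by rwa [extChartAt_source]))] with z hz
  have hz' := (extChartAt (𝓡 4) x).map_target hz
  rw [extChartAt_source] at hz'
  exact (trivializationAt_apply_eq_toChart hz' _).symm

theorem contDiffAt_formRep (hy : y ∈ (chartAt R4 x).source) {α : Π y : M, CSpace M y}
    (hα : ContMDiffAt (𝓡 4) ((𝓡 4).prod 𝓘(ℝ, R4 →L[ℝ] ℝ)) ∞
      (fun x ↦ (⟨x, α x⟩ : Bundle.TotalSpace (R4 →L[ℝ] ℝ) (CSpace M))) y) :
    ContDiffAt ℝ ∞ (formRep x α) (extChartAt (𝓡 4) x y) := by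
  have h := ((trivializationAt (R4 →L[ℝ] ℝ) (CSpace M) x).contMDiffAt_section_iff
    (by simpa using hy)).1 hα
  refine (contDiffAt_rep hy h).congr_of_eventuallyEq (Eventually.of_forall fun z ↦ ?_)
  simp only [Function.comp, hom_trivializationAt_apply]
  ext v
  simp [formRep, ofChart, ContinuousLinearMap.inCoordinates]
  rfl

theorem end_trivializationAt_apply (x y : M) (A : TSpace M y →L[ℝ] TSpace M y) :
    (trivializationAt (R4 →L[ℝ] R4) (fun x : M ↦ TSpace M x →L[ℝ] TSpace M x) x ⟨y, A⟩).2 =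
      ((toChart x y).comp A).comp (ofChart x y) := by
  rw [hom_trivializationAt_apply]
  rfl

theorem contDiffAt_endRep (hy : y ∈ (chartAt R4 x).source)
    {A : Π y : M, TSpace M y →L[ℝ] TSpace M y}
    (hA : ContMDiffAt (𝓡 4) ((𝓡 4).prod 𝓘(ℝ, R4 →L[ℝ] R4)) ∞
      (fun x ↦ (⟨x, A x⟩ : Bundle.TotalSpace (R4 →L[ℝ] R4)
        (fun x : M ↦ TSpace M x →L[ℝ] TSpace M x))) y) :
    ContDiffAt ℝ ∞ (endRep x A) (extChartAt (𝓡 4) x y) := by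
  have h := ((trivializationAt (R4 →L[ℝ] R4)
    (fun x : M ↦ TSpace M x →L[ℝ] TSpace M x) x).contMDiffAt_section_iff
    (by simpa using hy)).1 hA
  exact (contDiffAt_rep hy h).congr_of_eventuallyEq (Eventually.of_forall fun z ↦
    (end_trivializationAt_apply x _ (A _)).symm)

theorem cotangent_symm_apply (hy : y ∈ (chartAt R4 x).source) (β : R4 →L[ℝ] ℝ) :
    (trivializationAt (R4 →L[ℝ] ℝ) (CSpace M) x).symm y β = β.comp (toChart x y) := by
  have h := Bundle.Pretrivialization.continuousLinearMap_symm_apply' (RingHom.id ℝ)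
    (trivializationAt R4 (TSpace M) x) (trivializationAt ℝ (Bundle.Trivial M ℝ) x)
    (b := y) ⟨hy, Set.mem_univ _⟩ β
  refine h.trans ?_
  ext v
  simp
  rfl

theorem sharp_trivializationAt_apply (hy : y ∈ (chartAt R4 x).source)
    (S : CSpace M y →L[ℝ] TSpace M y) :
    (trivializationAt ((R4 →L[ℝ] ℝ) →L[ℝ] R4) (fun x : M ↦ CSpace M x →L[ℝ] TSpace M x) x
      ⟨y, S⟩).2 = ((toChart x y).comp S).comp (ContinuousLinearMap.precomp ℝ (toChart x y)) := by
  rw [hom_trivializationAt_apply]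
  ext1 β
  simp only [ContinuousLinearMap.inCoordinates, ContinuousLinearMap.comp_apply]
  rw [Bundle.Trivialization.symmL_apply, cotangent_symm_apply hy]
  · rfl
  · simpa using hy

/-- Smoothness of a contravariant tensor field can be checked on its components. -/
theorem contMDiffAt_sharp {S : Π y : M, CSpace M y →L[ℝ] TSpace M y}
    (hS : ContMDiffAt (𝓡 4) 𝓘(ℝ, (R4 →L[ℝ] ℝ) →L[ℝ] R4) ∞
      (fun y ↦ ((toChart x y).comp (S y)).comp (ContinuousLinearMap.precomp ℝ (toChart x y))) x) :
    ContMDiffAt (𝓡 4) ((𝓡 4).prod 𝓘(ℝ, (R4 →L[ℝ] ℝ) →L[ℝ] R4)) ∞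
      (fun x ↦ (⟨x, S x⟩ : Bundle.TotalSpace ((R4 →L[ℝ] ℝ) →L[ℝ] R4)
        (fun x : M ↦ CSpace M x →L[ℝ] TSpace M x))) x := by
  refine ((trivializationAt ((R4 →L[ℝ] ℝ) →L[ℝ] R4)
    (fun x : M ↦ CSpace M x →L[ℝ] TSpace M x) x).contMDiffAt_section_iff (by simp)).2 ?_
  refine hS.congr_of_eventuallyEq ?_
  filter_upwards [(chartAt R4 x).open_source.mem_nhds (mem_chart_source R4 x)] with z hz
    using sharp_trivializationAt_apply hz (S z)

theorem contDiffAt_sharpRep (hy : y ∈ (chartAt R4 x).source)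
    {S : Π y : M, CSpace M y →L[ℝ] TSpace M y}
    (hS : ContMDiffAt (𝓡 4) ((𝓡 4).prod 𝓘(ℝ, (R4 →L[ℝ] ℝ) →L[ℝ] R4)) ∞
      (fun x ↦ (⟨x, S x⟩ : Bundle.TotalSpace ((R4 →L[ℝ] ℝ) →L[ℝ] R4)
        (fun x : M ↦ CSpace M x →L[ℝ] TSpace M x))) y) :
    ContDiffAt ℝ ∞ (sharpRep x S) (extChartAt (𝓡 4) x y) := by
  have h := ((trivializationAt ((R4 →L[ℝ] ℝ) →L[ℝ] R4)
    (fun x : M ↦ CSpace M x →L[ℝ] TSpace M x) x).contMDiffAt_section_iff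
    (by simpa using hy)).1 hS
  refine (contDiffAt_rep hy h).congr_of_eventuallyEq ?_
  filter_upwards [(isOpen_extChartAt_target x).mem_nhds
    ((extChartAt (𝓡 4) x).map_source (by rwa [extChartAt_source]))] with z hz
  have hz' := (extChartAt (𝓡 4) x).map_target hz
  rw [extChartAt_source] at hz'
  exact (sharp_trivializationAt_apply hz' (S _)).symm

end Representatives

/-! ### Derivatives, brackets and connections in a chart -/

section ChartCalculus

open Filter Topology

variable {M : Type*} [TopologicalSpace M] [ChartedSpace R4 M]

theorem extChartAt_mem_target {x y : M} (hy : y ∈ (chartAt R4 x).source) :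
    extChartAt (𝓡 4) x y ∈ (extChartAt (𝓡 4) x).target :=
  (extChartAt (𝓡 4) x).map_source (by rwa [extChartAt_source])

theorem extChartAt_symm_mem_source {x : M} {z : R4} (hz : z ∈ (extChartAt (𝓡 4) x).target) :
    (extChartAt (𝓡 4) x).symm z ∈ (chartAt R4 x).source := by
  have h := (extChartAt (𝓡 4) x).map_target hz
  rwa [extChartAt_source] at h

variable [IsManifold (𝓡 4) ∞ M]

/-- The vector field with constant components `w` in the chart at `x`. -/
noncomputable def constVec (x : M) (w : R4) (y : M) : TSpace M y := ofChart x y w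

/-- The one-form with constant components `β` in the chart at `x`. -/
noncomputable def constForm (x : M) (β : R4 →L[ℝ] ℝ) (y : M) : CSpace M y :=
  β.comp (toChart x y)

/-- Smoothness of a vector field at a point. -/
def SmoothVectorAt (X : Π y : M, TSpace M y) (y : M) : Prop :=
  ContMDiffAt (𝓡 4) ((𝓡 4).prod 𝓘(ℝ, R4)) ∞
    (fun x ↦ (⟨x, X x⟩ : Bundle.TotalSpace R4 (TSpace M))) y

variable {x y : M}

theorem SmoothVectorOn.smoothVectorAt {X : Π y : M, TSpace M y} {U : Set M} (hU : IsOpen U)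
    (hX : SmoothVectorOn X U) (hy : y ∈ U) : SmoothVectorAt X y :=
  ContMDiffOn.contMDiffAt hX (hU.mem_nhds hy)

theorem SmoothVectorAt.mdifferentiableAt {X : Π y : M, TSpace M y} (hX : SmoothVectorAt X y) :
    MDifferentiableAt (𝓡 4) ((𝓡 4).prod 𝓘(ℝ, R4))
      (fun x ↦ (⟨x, X x⟩ : Bundle.TotalSpace R4 (TSpace M))) y :=
  ContMDiffAt.mdifferentiableAt hX (by simp)

theorem smoothVectorOn_constVec (x : M) (w : R4) :
    SmoothVectorOn (constVec x w) (chartAt R4 x).source := by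
  refine ((trivializationAt R4 (TSpace M) x).contMDiffOn_section_baseSet_iff).2 ?_
  refine (contMDiffOn_const (c := w)).congr fun y hy ↦ ?_
  exact (trivializationAt_apply_eq_toChart hy _).trans (toChart_ofChart hy w)

theorem smoothFormOn_constForm (x : M) (β : R4 →L[ℝ] ℝ) :
    SmoothFormOn (constForm x β) (chartAt R4 x).source := by
  have hb : (trivializationAt (R4 →L[ℝ] ℝ) (CSpace M) x).baseSet = (chartAt R4 x).source := by
    simp
  have h : SmoothFormOn (constForm x β)
      (trivializationAt (R4 →L[ℝ] ℝ) (CSpace M) x).baseSet := by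
    refine ((trivializationAt (R4 →L[ℝ] ℝ) (CSpace M) x).contMDiffOn_section_baseSet_iff).2 ?_
    refine (contMDiffOn_const (c := β)).congr fun y hy ↦ ?_
    have h := (trivializationAt (R4 →L[ℝ] ℝ) (CSpace M) x).apply_mk_symm hy β
    rw [cotangent_symm_apply (by rwa [hb] at hy)] at h
    exact congrArg Prod.snd h
  rwa [hb] at h

theorem coordField_eq (hy : y ∈ (chartAt R4 x).source) (i : Fin 4) :
    coordField x i y = constVec x (EuclideanSpace.single i 1) y := by
  have h : (trivializationAt R4 (TSpace M) x ⟨x, basisVec x i⟩).2 = EuclideanSpace.single i 1 := by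
    have h1 := congrArg (fun L ↦ L (EuclideanSpace.single i (1 : ℝ))) (toChart_self x)
    exact (trivializationAt_apply_eq_toChart (mem_chart_source R4 x) _).trans h1
  simp only [coordField, FiberBundle.extend]
  rw [h]
  exact ((trivializationAt R4 (TSpace M) x).symmL_apply hy _).symm

theorem vecRep_apply (hy : y ∈ (chartAt R4 x).source) (Y : Π y : M, TSpace M y) :
    vecRep x Y (extChartAt (𝓡 4) x y) = toChart x y (Y y) := by
  rw [vecRep, chart_left_inv hy]

theorem mfderiv_extChartAt_eq (hy : y ∈ (chartAt R4 x).source) :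
    mfderiv (𝓡 4) 𝓘(ℝ, R4) (extChartAt (𝓡 4) x) y = toChart x y :=
  (TangentBundle.continuousLinearMapAt_trivializationAt hy).symm

theorem mfderiv_extChartAt_symm_eq {z : R4} (hz : z ∈ (extChartAt (𝓡 4) x).target) :
    mfderiv 𝓘(ℝ, R4) (𝓡 4) (extChartAt (𝓡 4) x).symm z =
      ofChart x ((extChartAt (𝓡 4) x).symm z) := by
  have h := TangentBundle.symmL_trivializationAt (I := 𝓡 4) (extChartAt_symm_mem_source hz)
  rw [(extChartAt (𝓡 4) x).right_inv hz] at h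
  rw [← mfderivWithin_univ]
  simp only [modelWithCornersSelf_coe, Set.range_id] at h
  exact h.symm

theorem dirDeriv_eq (hy : y ∈ (chartAt R4 x).source) {f : M → ℝ}
    (hf : MDifferentiableAt (𝓡 4) 𝓘(ℝ, ℝ) f y) (v : TSpace M y) :
    dirDeriv f y v =
      fderiv ℝ (f ∘ (extChartAt (𝓡 4) x).symm) (extChartAt (𝓡 4) x y) (toChart x y v) := by
  have h1 : f =ᶠ[𝓝 y] (f ∘ (extChartAt (𝓡 4) x).symm) ∘ extChartAt (𝓡 4) x := by
    filter_upwards [(chartAt R4 x).open_source.mem_nhds hy] with w hw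
    simp only [Function.comp, chart_left_inv hw]
  have h2 : MDifferentiableAt 𝓘(ℝ, R4) 𝓘(ℝ, ℝ) (f ∘ (extChartAt (𝓡 4) x).symm)
      (extChartAt (𝓡 4) x y) := by
    refine MDifferentiableAt.comp _ ?_ ((contMDiffAt_chart_symm hy).mdifferentiableAt (by simp))
    rwa [chart_left_inv hy]
  rw [dirDeriv, h1.mfderiv_eq, mfderiv_comp y h2 (mdifferentiableAt_extChartAt hy),
    mfderiv_extChartAt_eq hy, mfderiv_eq_fderiv]
  rfl

theorem mpullback_chart_symm (X : Π y : M, TSpace M y) {z : R4}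
    (hz : z ∈ (extChartAt (𝓡 4) x).target) :
    VectorField.mpullback 𝓘(ℝ, R4) (𝓡 4) (extChartAt (𝓡 4) x).symm X z = vecRep x X z := by
  have hs := extChartAt_symm_mem_source hz
  have hinv : (ofChart x ((extChartAt (𝓡 4) x).symm z)).inverse =
      toChart x ((extChartAt (𝓡 4) x).symm z) :=
    ContinuousLinearMap.inverse_eq (by ext1 v; exact ofChart_toChart hs v)
      (by ext1 v; exact toChart_ofChart hs v)
  rw [VectorField.mpullback_apply, mfderiv_extChartAt_symm_eq hz, vecRep]
  exact congrArg (fun L ↦ L (X ((extChartAt (𝓡 4) x).symm z))) hinv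

theorem mlieBracket_vectorSpace {F : Type*} [NormedAddCommGroup F] [NormedSpace ℝ F] (V W : F → F)
    (z : F) : VectorField.mlieBracket 𝓘(ℝ, F) (M := F) V W z =
      fderiv ℝ W z (V z) - fderiv ℝ V z (W z) := by
  have h : VectorField.mlieBracketWithin 𝓘(ℝ, F) (M := F) V W Set.univ z =
      VectorField.lieBracketWithin ℝ V W Set.univ z :=
    congrFun VectorField.mlieBracketWithin_eq_lieBracketWithin z
  rw [VectorField.lieBracketWithin_univ] at h
  exact h

theorem bracket_eq (hy : y ∈ (chartAt R4 x).source) {X Y : Π y : M, TSpace M y}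
    (hX : SmoothVectorAt X y) (hY : SmoothVectorAt Y y) :
    toChart x y (bracket X Y y) =
      fderiv ℝ (vecRep x Y) (extChartAt (𝓡 4) x y) (toChart x y (X y))
        - fderiv ℝ (vecRep x X) (extChartAt (𝓡 4) x y) (toChart x y (Y y)) := by
  have hz := extChartAt_mem_target hy
  have : IsManifold (𝓡 4) (minSmoothness ℝ 2) M := by
    rw [minSmoothness_of_isRCLikeNormedField]
    infer_instance
  have h := VectorField.mpullback_mlieBracket (n := ∞) (I := 𝓘(ℝ, R4)) (I' := 𝓡 4)
    (f := (extChartAt (𝓡 4) x).symm) (V := X) (W := Y) (x₀ := extChartAt (𝓡 4) x y)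
    (by rw [chart_left_inv hy]; exact hX.mdifferentiableAt)
    (by rw [chart_left_inv hy]; exact hY.mdifferentiableAt) (contMDiffAt_chart_symm hy)
    (by simpa using WithTop.coe_le_coe.2 (le_top (a := (2 : ℕ∞))))
  have hev : ∀ X : Π y : M, TSpace M y,
      VectorField.mpullback 𝓘(ℝ, R4) (𝓡 4) (extChartAt (𝓡 4) x).symm X
        =ᶠ[𝓝 (extChartAt (𝓡 4) x y)] vecRep x X := fun X ↦ by
    filter_upwards [(isOpen_extChartAt_target x).mem_nhds hz] with z hz
      using mpullback_chart_symm X hz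
  rw [mpullback_chart_symm _ hz, (hev X).mlieBracket_vectorField_eq (hev Y), vecRep_apply hy] at h
  refine h.trans ?_
  refine (mlieBracket_vectorSpace _ _ _).trans ?_
  rw [vecRep_apply hy, vecRep_apply hy]

end ChartCalculus

/-! ### The Christoffel map of a connection -/

section ChartConnection

open Filter Topology

variable {M : Type*} [TopologicalSpace M] [ChartedSpace R4 M] [IsManifold (𝓡 4) ∞ M]

/-- The Christoffel map of the connection `D` in the chart at `x`:
`(v, w) ↦ ∑ⱼ wʲ ∇_v ∂ⱼ`. -/
noncomputable def christoffel (x : M) (D : Connection M) (z : R4) : R4 →L[ℝ] R4 →L[ℝ] R4 :=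
  (∑ j : Fin 4, (EuclideanSpace.proj j : R4 →L[ℝ] ℝ).smulRight
    (endRep x (D (constVec x (EuclideanSpace.single j 1))) z)).flip

variable {x y : M}

theorem christoffel_apply (x : M) (D : Connection M) (z v w : R4) :
    christoffel x D z v w =
      ∑ j, w j • endRep x (D (constVec x (EuclideanSpace.single j 1))) z v := by
  simp [christoffel]

theorem contDiffAt_christoffel {D : Connection M} (hD : SmoothConnection D)
    (hy : y ∈ (chartAt R4 x).source) :
    ContDiffAt ℝ ∞ (christoffel x D) (extChartAt (𝓡 4) x y) := by
  have h : ContDiffAt ℝ ∞ (fun z ↦ ∑ j : Fin 4, (EuclideanSpace.proj j : R4 →L[ℝ] ℝ).smulRight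
      (endRep x (D (constVec x (EuclideanSpace.single j 1))) z)) (extChartAt (𝓡 4) x y) := by
    refine ContDiffAt.sum fun j _ ↦ ?_
    have h1 := (hD _ (chartAt R4 x).open_source).contMDiff
      (σ := constVec x (EuclideanSpace.single j 1)) (by
        simpa using! smoothVectorOn_constVec x (EuclideanSpace.single j 1))
    have h2 := contDiffAt_endRep hy (h1.contMDiffAt ((chartAt R4 x).open_source.mem_nhds hy))
    exact contDiffAt_const.smulRight h2
  exact contDiffAt_flip h

theorem connection_sum (D : Connection M) {ι : Type*} (s : Finset ι)
    {σ : ι → Π y : M, TSpace M y} (hσ : ∀ i, SmoothVectorAt (σ i) y) :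
    SmoothVectorAt (∑ i ∈ s, σ i) y ∧ D (∑ i ∈ s, σ i) y = ∑ i ∈ s, D (σ i) y := by
  classical
  induction s using Finset.induction_on with
  | empty =>
    refine ⟨?_, ?_⟩
    · exact (Bundle.contMDiff_zeroSection ℝ (TSpace M)).contMDiffAt
    · simp
  | insert i s hi ih =>
    rw [Finset.sum_insert hi, Finset.sum_insert hi]
    refine ⟨ContMDiffAt.add_section (hσ i) ih.1, ?_⟩
    rw [D.isCovariantDerivativeOn.add (hσ i).mdifferentiableAt ih.1.mdifferentiableAt, ih.2]

theorem smoothVectorAt_smul {f : M → ℝ} {X : Π y : M, TSpace M y}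
    (hf : ContMDiffAt (𝓡 4) 𝓘(ℝ, ℝ) ∞ f y) (hX : SmoothVectorAt X y) :
    SmoothVectorAt (f • X) y :=
  ContMDiffAt.smul_section hf hX

theorem connection_smul (D : Connection M) {f : M → ℝ} {X : Π y : M, TSpace M y}
    (hf : MDifferentiableAt (𝓡 4) 𝓘(ℝ, ℝ) f y) (hX : SmoothVectorAt X y) (v : TSpace M y) :
    D (f • X) y v = f y • D X y v + dirDeriv f y v • X y := by
  rw [D.isCovariantDerivativeOn.leibniz hX.mdifferentiableAt hf]
  rfl

theorem connection_congr (D : Connection M) {X Y : Π y : M, TSpace M y}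
    (hX : SmoothVectorAt X y) (hY : SmoothVectorAt Y y) (h : ∀ᶠ w in 𝓝 y, X w = Y w) :
    D X y = D Y y :=
  D.isCovariantDerivativeOn.congr_of_eventuallyEq hX.mdifferentiableAt hY.mdifferentiableAt
    univ_mem h

theorem contMDiffAt_comp_chart {F : Type*} [NormedAddCommGroup F] [NormedSpace ℝ F] {f : R4 → F}
    (hy : y ∈ (chartAt R4 x).source) (hf : ContDiffAt ℝ ∞ f (extChartAt (𝓡 4) x y)) :
    ContMDiffAt (𝓡 4) 𝓘(ℝ, F) ∞ (f ∘ extChartAt (𝓡 4) x) y :=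
  ContMDiffAt.comp y hf.contMDiffAt (contMDiffAt_extChartAt' hy)

/-- The covariant derivative of a vector field in the chart at `x`. -/
theorem toChart_connection (D : Connection M) (hy : y ∈ (chartAt R4 x).source)
    {Y : Π y : M, TSpace M y} (hY : SmoothVectorAt Y y) (v : TSpace M y) :
    toChart x y (D Y y v) =
      covDeriv (christoffel x D) (vecRep x Y) (extChartAt (𝓡 4) x y) (toChart x y v) := by
  have hYr := contDiffAt_vecRep hy hY
  set c : Fin 4 → M → ℝ := fun j w ↦ vecRep x Y (extChartAt (𝓡 4) x w) j with hc
  have hcs : ∀ j, ContMDiffAt (𝓡 4) 𝓘(ℝ, ℝ) ∞ (c j) y := fun j ↦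
    contMDiffAt_comp_chart (f := fun z ↦ vecRep x Y z j) hy
      ((EuclideanSpace.proj j : R4 →L[ℝ] ℝ).contDiff.contDiffAt.comp _ hYr)
  have hconst : ∀ j, SmoothVectorAt (constVec x (EuclideanSpace.single j (1 : ℝ))) y := fun j ↦
    (smoothVectorOn_constVec x _).smoothVectorAt (chartAt R4 x).open_source hy
  have hsum := connection_sum D Finset.univ
    (σ := fun j ↦ c j • constVec x (EuclideanSpace.single j (1 : ℝ)))
    fun j ↦ smoothVectorAt_smul (hcs j) (hconst j)
  have hbasis : ∀ w : R4, ∑ j, w j • EuclideanSpace.single j (1 : ℝ) = w := fun w ↦ by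
    simpa using (EuclideanSpace.basisFun (Fin 4) ℝ).sum_repr w
  have hev : ∀ᶠ w in 𝓝 y, Y w =
      (∑ j, c j • constVec x (EuclideanSpace.single j (1 : ℝ)) : Π y : M, TSpace M y) w := by
    filter_upwards [(chartAt R4 x).open_source.mem_nhds hy] with w hw
    rw [Finset.sum_apply]
    have h1 := congrArg (ofChart x w) (hbasis (vecRep x Y (extChartAt (𝓡 4) x w)))
    rw [vecRep_apply hw, ofChart_toChart hw, map_sum] at h1
    rw [← h1]
    refine Finset.sum_congr rfl fun j _ ↦ ?_
    rw [map_smul, ← vecRep_apply hw]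
    rfl
  -- expand `Y` in the coordinate fields and use the Leibniz rule for each term
  rw [connection_congr D hY hsum.1 hev, hsum.2, _root_.sum_apply, map_sum,
    covDeriv_apply, christoffel_apply]
  have hterm : ∀ j, toChart x y (D (c j • constVec x (EuclideanSpace.single j (1 : ℝ))) y v) =
      (fderiv ℝ (vecRep x Y) (extChartAt (𝓡 4) x y) (toChart x y v)) j •
        EuclideanSpace.single j (1 : ℝ) +
      vecRep x Y (extChartAt (𝓡 4) x y) j •
        endRep x (D (constVec x (EuclideanSpace.single j 1))) (extChartAt (𝓡 4) x y)
          (toChart x y v) := fun j ↦ by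
    rw [connection_smul D ((hcs j).mdifferentiableAt (by simp)) (hconst j), map_add, map_smul,
      map_smul, constVec, toChart_ofChart hy, add_comm]
    congr 1
    · congr 1
      rw [dirDeriv_eq hy ((hcs j).mdifferentiableAt (by simp))]
      have h1 : c j ∘ (extChartAt (𝓡 4) x).symm =ᶠ[𝓝 (extChartAt (𝓡 4) x y)]
          (EuclideanSpace.proj j : R4 →L[ℝ] ℝ) ∘ vecRep x Y := by
        filter_upwards [(isOpen_extChartAt_target x).mem_nhds (extChartAt_mem_target hy)] with z hz
        simp only [hc, Function.comp, (extChartAt (𝓡 4) x).right_inv hz]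
        rfl
      rw [h1.fderiv_eq, ((EuclideanSpace.proj j : R4 →L[ℝ] ℝ).hasFDerivAt.comp _
        (hasFDerivAt_of_smooth hYr)).fderiv]
      rfl
    · simp only [endRep, ContinuousLinearMap.comp_apply]
      rw [chart_left_inv hy, ofChart_toChart hy]
  rw [Finset.sum_congr rfl fun j _ ↦ hterm j, Finset.sum_add_distrib, hbasis]

end ChartConnection

/-! ### One-forms and Galilei connections in a chart -/

section Bridge

open Filter Topology

variable {M : Type*} [TopologicalSpace M] [ChartedSpace R4 M] [IsManifold (𝓡 4) ∞ M]
variable {x y : M}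

theorem formRep_apply (hy : y ∈ (chartAt R4 x).source) (α : Π y : M, CSpace M y) (v : TSpace M y) :
    formRep x α (extChartAt (𝓡 4) x y) (toChart x y v) = α y v := by
  simp only [formRep, ContinuousLinearMap.comp_apply]
  rw [chart_left_inv hy, ofChart_toChart hy]

theorem sharpRep_apply (hy : y ∈ (chartAt R4 x).source)
    (S : Π y : M, CSpace M y →L[ℝ] TSpace M y) (β : R4 →L[ℝ] ℝ) :
    sharpRep x S (extChartAt (𝓡 4) x y) β = toChart x y (S y (constForm x β y)) := by
  simp only [sharpRep, ContinuousLinearMap.comp_apply]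
  rw [chart_left_inv hy]
  rfl

theorem vecRep_constVec (w : R4) {z : R4} (hz : z ∈ (extChartAt (𝓡 4) x).target) :
    vecRep x (constVec x w) z = w :=
  toChart_ofChart (extChartAt_symm_mem_source hz) w

theorem smoothVectorAt_constVec (hy : y ∈ (chartAt R4 x).source) (w : R4) :
    SmoothVectorAt (constVec x w) y :=
  (smoothVectorOn_constVec x w).smoothVectorAt (chartAt R4 x).open_source hy

theorem fderiv_vecRep_constVec (hy : y ∈ (chartAt R4 x).source) (w : R4) :
    fderiv ℝ (vecRep x (constVec x w)) (extChartAt (𝓡 4) x y) = 0 := by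
  have h : vecRep x (constVec x w) =ᶠ[𝓝 (extChartAt (𝓡 4) x y)] fun _ ↦ w := by
    filter_upwards [(isOpen_extChartAt_target x).mem_nhds (extChartAt_mem_target hy)] with z hz
      using vecRep_constVec w hz
  rw [h.fderiv_eq]
  simp

theorem toChart_connection_constVec (D : Connection M) (hy : y ∈ (chartAt R4 x).source)
    (v : TSpace M y) (w : R4) : toChart x y (D (constVec x w) y v) =
      christoffel x D (extChartAt (𝓡 4) x y) (toChart x y v) w := by
  rw [toChart_connection D hy (smoothVectorAt_constVec hy w), covDeriv_apply,
    fderiv_vecRep_constVec hy, vecRep_constVec w (extChartAt_mem_target hy)]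
  simp

/-- The Christoffel map of a torsion-free connection is symmetric: coordinate fields commute. -/
theorem christoffel_symm {D : Connection M} (hD : D.torsion = 0)
    (hy : y ∈ (chartAt R4 x).source) (v w : R4) :
    christoffel x D (extChartAt (𝓡 4) x y) v w = christoffel x D (extChartAt (𝓡 4) x y) w v := by
  have h := D.torsion_eq_zero_iff.1 hD (smoothVectorAt_constVec hy v).mdifferentiableAt
    (smoothVectorAt_constVec hy w).mdifferentiableAt
  have h1 := congrArg (toChart x y) h
  have h2 := bracket_eq hy (smoothVectorAt_constVec hy v) (smoothVectorAt_constVec hy w)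
  rw [bracket] at h2
  rw [h2, map_sub, toChart_connection_constVec D hy, toChart_connection_constVec D hy,
    fderiv_vecRep_constVec hy, fderiv_vecRep_constVec hy] at h1
  simp only [constVec, toChart_ofChart hy] at h1
  simpa [sub_eq_zero] using h1

/-- The function `y ↦ α y (Y y)` in the chart. -/
theorem pairing_comp_chart_symm (α : Π y : M, CSpace M y) (Y : Π y : M, TSpace M y) {z : R4}
    (hz : z ∈ (extChartAt (𝓡 4) x).target) :
    ((fun y ↦ α y (Y y)) ∘ (extChartAt (𝓡 4) x).symm) z = formRep x α z (vecRep x Y z) := by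
  simp only [Function.comp, formRep, vecRep, ContinuousLinearMap.comp_apply]
  rw [ofChart_toChart (extChartAt_symm_mem_source hz)]

/-- Smoothness of a one-form at a point. -/
def SmoothFormAt (α : Π y : M, CSpace M y) (y : M) : Prop :=
  ContMDiffAt (𝓡 4) ((𝓡 4).prod 𝓘(ℝ, R4 →L[ℝ] ℝ)) ∞
    (fun x ↦ (⟨x, α x⟩ : Bundle.TotalSpace (R4 →L[ℝ] ℝ) (CSpace M))) y

theorem SmoothFormOn.smoothFormAt {α : Π y : M, CSpace M y} {U : Set M} (hU : IsOpen U)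
    (hα : SmoothFormOn α U) (hy : y ∈ U) : SmoothFormAt α y :=
  ContMDiffOn.contMDiffAt hα (hU.mem_nhds hy)

theorem smoothFormAt_constForm (hy : y ∈ (chartAt R4 x).source) (β : R4 →L[ℝ] ℝ) :
    SmoothFormAt (constForm x β) y :=
  (smoothFormOn_constForm x β).smoothFormAt (chartAt R4 x).open_source hy

theorem SmoothFormAt.pairing {α : Π y : M, CSpace M y} {Y : Π y : M, TSpace M y}
    (hα : SmoothFormAt α y) (hY : SmoothVectorAt Y y) :
    ContMDiffAt (𝓡 4) 𝓘(ℝ, ℝ) ∞ (fun y ↦ α y (Y y)) y := by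
  have h1 := contDiffAt_formRep (mem_chart_source R4 y) hα
  have h2 := contDiffAt_vecRep (mem_chart_source R4 y) hY
  refine (contMDiffAt_comp_chart (mem_chart_source R4 y) (h1.clm_apply h2)).congr_of_eventuallyEq ?_
  filter_upwards [(chartAt R4 y).open_source.mem_nhds (mem_chart_source R4 y)] with w hw
  simp only [Function.comp, vecRep_apply hw]
  rw [formRep_apply hw]

theorem dirDeriv_pairing (hy : y ∈ (chartAt R4 x).source) {α : Π y : M, CSpace M y}
    {Y : Π y : M, TSpace M y} (hα : SmoothFormAt α y) (hY : SmoothVectorAt Y y) (v : TSpace M y) :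
    dirDeriv (fun y ↦ α y (Y y)) y v =
      fderiv ℝ (fun z ↦ formRep x α z (vecRep x Y z)) (extChartAt (𝓡 4) x y) (toChart x y v) := by
  rw [dirDeriv_eq hy ((hα.pairing hY).mdifferentiableAt (by simp))]
  have h : (fun y ↦ α y (Y y)) ∘ (extChartAt (𝓡 4) x).symm =ᶠ[𝓝 (extChartAt (𝓡 4) x y)]
      fun z ↦ formRep x α z (vecRep x Y z) := by
    filter_upwards [(isOpen_extChartAt_target x).mem_nhds (extChartAt_mem_target hy)] with z hz
      using pairing_comp_chart_symm α Y hz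
  rw [h.fderiv_eq]

theorem formRep_constForm (β : R4 →L[ℝ] ℝ) {z : R4} (hz : z ∈ (extChartAt (𝓡 4) x).target) :
    formRep x (constForm x β) z = β := by
  ext v
  simp only [formRep, constForm, ContinuousLinearMap.comp_apply]
  rw [toChart_ofChart (extChartAt_symm_mem_source hz)]

theorem dirDeriv_constForm (hy : y ∈ (chartAt R4 x).source) (β : R4 →L[ℝ] ℝ)
    {Y : Π y : M, TSpace M y} (hY : SmoothVectorAt Y y) (v : TSpace M y) :
    dirDeriv (fun y ↦ constForm x β y (Y y)) y v =
      β (fderiv ℝ (vecRep x Y) (extChartAt (𝓡 4) x y) (toChart x y v)) := by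
  rw [dirDeriv_pairing hy (smoothFormAt_constForm hy β) hY]
  have h : (fun z ↦ formRep x (constForm x β) z (vecRep x Y z)) =ᶠ[𝓝 (extChartAt (𝓡 4) x y)]
      β ∘ vecRep x Y := by
    filter_upwards [(isOpen_extChartAt_target x).mem_nhds (extChartAt_mem_target hy)] with z hz
    rw [formRep_constForm β hz]
    rfl
  rw [h.fderiv_eq, (β.hasFDerivAt.comp _ (hasFDerivAt_of_smooth (contDiffAt_vecRep hy hY))).fderiv]
  rfl

/-- A constant one-form is differentiated by the Christoffel map alone. -/
theorem covForm_constForm (D : Connection M) (hy : y ∈ (chartAt R4 x).source) (β : R4 →L[ℝ] ℝ)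
    {Y : Π y : M, TSpace M y} (hY : SmoothVectorAt Y y) (v : TSpace M y) :
    covForm D (constForm x β) Y y v =
      -β (christoffel x D (extChartAt (𝓡 4) x y) (toChart x y v) (toChart x y (Y y))) := by
  rw [covForm, dirDeriv_constForm hy β hY]
  change _ - β (toChart x y (D Y y v)) = _
  rw [toChart_connection D hy hY, covDeriv_apply, map_add, vecRep_apply hy]
  ring

theorem smoothVectorAt_sharp (𝔤 : GalileiMetric M) {α : Π y : M, CSpace M y}
    (hα : SmoothFormAt α y) : SmoothVectorAt (fun y ↦ 𝔤.sharp y (α y)) y :=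
  ContMDiffAt.clm_bundle_apply (𝔤.smooth_sharp y) hα

/-- In the chart at `x`, a Galilei connection and a timelike unit field are given by an
`IsGalileiChart`. -/
theorem IsGalileiConnection.isGalileiChart {𝔤 : GalileiMetric M} {D : Connection M}
    (hD : IsGalileiConnection 𝔤 D) {u : Π y : M, TSpace M y} (hu : IsTimelikeUnit 𝔤 u) (x : M) :
    IsGalileiChart (extChartAt (𝓡 4) x).target (christoffel x D) (formRep x 𝔤.τ)
      (sharpRep x fun y ↦ 𝔤.sharp y) (vecRep x u) := by
  have hsm : ∀ z ∈ (extChartAt (𝓡 4) x).target, ∃ y ∈ (chartAt R4 x).source,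
      extChartAt (𝓡 4) x y = z := fun z hz ↦
    ⟨_, extChartAt_symm_mem_source hz, (extChartAt (𝓡 4) x).right_inv hz⟩
  have hτs : ∀ y, SmoothFormAt 𝔤.τ y := fun y ↦
    SmoothFormOn.smoothFormAt isOpen_univ 𝔤.smooth_τ (Set.mem_univ y)
  refine
    { isOpen := isOpen_extChartAt_target x
      smooth_Γ := ?_, smooth_τ := ?_, smooth_H := ?_, smooth_u := ?_, Γ_symm := ?_, fderiv_τ := ?_
      fderiv_H := ?_, symm := ?_, nonneg := ?_, apply_τ := ?_, null := ?_, unit := ?_ } <;>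
  intro z hz <;> obtain ⟨y, hy, rfl⟩ := hsm z hz
  · exact contDiffAt_christoffel hD.smooth hy
  · exact contDiffAt_formRep hy (hτs y)
  · exact contDiffAt_sharpRep hy (𝔤.smooth_sharp y)
  · exact contDiffAt_vecRep hy (hu.smooth.smoothVectorAt isOpen_univ (Set.mem_univ y))
  · exact christoffel_symm hD.torsion_free hy
  · intro v w
    have h := hD.τ_parallel _ (chartAt R4 x).open_source _ (smoothVectorOn_constVec x w) y hy
      (ofChart x y v)
    rw [covForm, dirDeriv_pairing hy (hτs y) (smoothVectorAt_constVec hy w), toChart_ofChart hy,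
      ← formRep_apply hy, toChart_connection_constVec D hy, toChart_ofChart hy] at h
    have h1 : (fun z ↦ formRep x 𝔤.τ z (vecRep x (constVec x w) z))
        =ᶠ[𝓝 (extChartAt (𝓡 4) x y)] fun z ↦ formRep x 𝔤.τ z w := by
      filter_upwards [(isOpen_extChartAt_target x).mem_nhds (extChartAt_mem_target hy)] with z hz
      rw [vecRep_constVec w hz]
    rw [h1.fderiv_eq, ((hasFDerivAt_of_smooth (contDiffAt_formRep hy (hτs y))).clm_apply
      (hasFDerivAt_const w _)).fderiv] at h
    simpa [sub_eq_zero] using h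
  · intro v α β
    have hs : ∀ β : R4 →L[ℝ] ℝ, SmoothVectorAt (fun y ↦ 𝔤.sharp y (constForm x β y)) y := fun β ↦
      smoothVectorAt_sharp 𝔤 (smoothFormAt_constForm hy β)
    have h := hD.h_parallel _ (chartAt R4 x).open_source _ _ (smoothFormOn_constForm x α)
      (smoothFormOn_constForm x β) y hy (ofChart x y v)
    rw [covTensor, dirDeriv_constForm hy α (hs β), covForm_constForm D hy α (hs β),
      covForm_constForm D hy β (hs α), toChart_ofChart hy, ← sharpRep_apply hy,
      ← sharpRep_apply hy] at h
    have h1 : vecRep x (fun y ↦ 𝔤.sharp y (constForm x β y)) =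
        fun z ↦ sharpRep x (fun y ↦ 𝔤.sharp y) z β := rfl
    rw [h1, ((hasFDerivAt_of_smooth (contDiffAt_sharpRep hy (𝔤.smooth_sharp y))).clm_apply
      (hasFDerivAt_const β _)).fderiv] at h
    simp only [_root_.add_apply, ContinuousLinearMap.comp_apply, ContinuousLinearMap.flip_apply,
      _root_.zero_apply, map_zero, zero_add] at h
    linarith
  · intro α β
    rw [sharpRep_apply hy, sharpRep_apply hy]
    exact 𝔤.symm y (constForm x α y) (constForm x β y)
  · intro α
    rw [sharpRep_apply hy]
    exact 𝔤.nonneg y (constForm x α y)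
  · rw [sharpRep_apply hy]
    have h : constForm x (formRep x 𝔤.τ (extChartAt (𝓡 4) x y)) y = 𝔤.τ y := by
      ext v
      exact formRep_apply hy 𝔤.τ v
    rw [h, 𝔤.sharp_τ, map_zero]
  · intro α h
    rw [sharpRep_apply hy] at h
    obtain ⟨c, hc⟩ := 𝔤.null y (constForm x α y) h
    refine ⟨c, ?_⟩
    ext v
    have h1 := congrArg (fun L : CSpace M y ↦ L (ofChart x y v)) hc
    simp only [constForm, ContinuousLinearMap.comp_apply, toChart_ofChart hy] at h1
    rw [h1]
    simp only [_root_.smul_apply]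
    rw [← formRep_apply hy, toChart_ofChart hy]
  · rw [vecRep_apply hy, formRep_apply hy, hu.unit]

end Bridge

/-! ### Curvature, kinematics and conservation laws in a chart -/

section Kinematics

open Filter Topology

variable {M : Type*} [TopologicalSpace M] [ChartedSpace R4 M] {x y : M}

theorem sum_basisCovec_basisVec (v : TSpace M x) : ∑ i, basisCovec x i v • basisVec x i = v := by
  have h := (EuclideanSpace.basisFun (Fin 4) ℝ).sum_repr (v : R4)
  refine Eq.trans ?_ h
  refine Finset.sum_congr rfl fun i _ ↦ ?_
  rw [EuclideanSpace.basisFun_apply]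
  rfl

variable [IsManifold (𝓡 4) ∞ M]

theorem smoothVectorOn_connection {D : Connection M} (hD : SmoothConnection D) {U : Set M}
    (hU : IsOpen U) {Y Z : Π y : M, TSpace M y} (hZ : SmoothVectorOn Z U)
    (hY : SmoothVectorOn Y U) : SmoothVectorOn (fun y ↦ D Z y (Y y)) U := by
  have h1 := (hD U hU).contMDiff (σ := Z) (by simpa using! hZ)
  exact ContMDiffOn.clm_bundle_apply h1 hY

theorem vecRep_connection (D : Connection M) {U : Set M} (hU : IsOpen U)
    {Y Z : Π y : M, TSpace M y} (hZ : SmoothVectorOn Z U) (hy : y ∈ (chartAt R4 x).source)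
    (hyU : y ∈ U) : vecRep x (fun y ↦ D Z y (Y y)) =ᶠ[𝓝 (extChartAt (𝓡 4) x y)]
      fun z ↦ covDeriv (christoffel x D) (vecRep x Z) z (vecRep x Y z) := by
  have hc : ContinuousAt (extChartAt (𝓡 4) x).symm (extChartAt (𝓡 4) x y) :=
    (contMDiffAt_chart_symm hy).continuousAt
  have hU' : (extChartAt (𝓡 4) x).symm ⁻¹' U ∈ 𝓝 (extChartAt (𝓡 4) x y) :=
    hc (hU.mem_nhds (by rwa [chart_left_inv hy]))
  filter_upwards [(isOpen_extChartAt_target x).mem_nhds (extChartAt_mem_target hy), hU']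
    with z hz hzU
  have hs := extChartAt_symm_mem_source hz
  have h := toChart_connection D hs (hZ.smoothVectorAt hU hzU)
    (Y ((extChartAt (𝓡 4) x).symm z))
  rw [(extChartAt (𝓡 4) x).right_inv hz] at h
  exact h

/-- The curvature of a connection in the chart at `x`. -/
theorem toChart_curvature {D : Connection M} (hD : SmoothConnection D) {U : Set M} (hU : IsOpen U)
    {X Y Z : Π y : M, TSpace M y} (hX : SmoothVectorOn X U) (hY : SmoothVectorOn Y U)
    (hZ : SmoothVectorOn Z U) (hy : y ∈ (chartAt R4 x).source) (hyU : y ∈ U) :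
    toChart x y (curvature D X Y Z y) =
      christoffelCurvature (christoffel x D) (extChartAt (𝓡 4) x y) (toChart x y (X y))
        (toChart x y (Y y)) (toChart x y (Z y)) := by
  have sX := hX.smoothVectorAt hU hyU
  have sY := hY.smoothVectorAt hU hyU
  have sZ := hZ.smoothVectorAt hU hyU
  have hΓ := contDiffAt_christoffel hD hy
  have rZ := contDiffAt_vecRep hy sZ
  have key : ∀ X Y : Π y : M, TSpace M y, SmoothVectorOn X U → SmoothVectorOn Y U →
      toChart x y (D (fun y ↦ D Z y (Y y)) y (X y)) =
        covDeriv (christoffel x D) (vecRep x Z) (extChartAt (𝓡 4) x y)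
          (fderiv ℝ (vecRep x Y) (extChartAt (𝓡 4) x y) (toChart x y (X y)))
        + fderiv ℝ (covDeriv (christoffel x D) (vecRep x Z)) (extChartAt (𝓡 4) x y)
          (toChart x y (X y)) (toChart x y (Y y))
        + christoffel x D (extChartAt (𝓡 4) x y) (toChart x y (X y))
          (covDeriv (christoffel x D) (vecRep x Z) (extChartAt (𝓡 4) x y)
            (toChart x y (Y y))) := by
    intro X Y hX hY
    have h1 := vecRep_connection D (Y := Y) hU hZ hy hyU
    have h2 := (hasFDerivAt_of_smooth (contDiffAt_covDeriv hΓ rZ)).clm_apply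
      (hasFDerivAt_of_smooth (contDiffAt_vecRep hy (hY.smoothVectorAt hU hyU)))
    rw [toChart_connection D hy ((smoothVectorOn_connection hD hU hZ hY).smoothVectorAt hU hyU),
      covDeriv_apply, h1.fderiv_eq, h1.self_of_nhds, h2.fderiv]
    simp only [_root_.add_apply, ContinuousLinearMap.comp_apply, ContinuousLinearMap.flip_apply,
      vecRep_apply hy]
  have h3 := christoffelCurvature_apply hΓ rZ (toChart x y (X y)) (toChart x y (Y y))
  rw [vecRep_apply hy] at h3
  rw [curvature, map_sub, map_sub, key X Y hX hY, key Y X hY hX, h3, toChart_connection D hy sZ,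
    bracket_eq hy sX sY, map_sub]
  abel

theorem SmoothVectorOn.congr {X Y : Π y : M, TSpace M y} {U : Set M} (hX : SmoothVectorOn X U)
    (h : ∀ y ∈ U, Y y = X y) : SmoothVectorOn Y U :=
  ContMDiffOn.congr hX fun y hy ↦ by rw [h y hy]

theorem trace_eq_sum_coord (T : R4 →ₗ[ℝ] R4) :
    LinearMap.trace ℝ R4 T = ∑ i, (T (EuclideanSpace.single i 1)) i := by
  rw [LinearMap.trace_eq_sum_inner T (EuclideanSpace.basisFun (Fin 4) ℝ)]
  simp [EuclideanSpace.inner_single_left]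

/-- The Ricci tensor as a trace of the curvature of the Christoffel map. -/
theorem ricci_eq_trace {D : Connection M} (hD : SmoothConnection D) {U : Set M} (hU : IsOpen U)
    {X Y : Π y : M, TSpace M y} (hX : SmoothVectorOn X U) (hY : SmoothVectorOn Y U) (hx : x ∈ U) :
    ricci D X Y x = LinearMap.trace ℝ R4
      (((christoffelCurvatureₗ (christoffel x D) (extChartAt (𝓡 4) x x)).flip
        (toChart x x (Y x))).flip (toChart x x (X x))) := by
  have hs := mem_chart_source R4 x
  have hU' : IsOpen (U ∩ (chartAt R4 x).source) := hU.inter (chartAt R4 x).open_source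
  rw [ricci, trace_eq_sum_coord]
  refine Finset.sum_congr rfl fun i _ ↦ ?_
  have hc : SmoothVectorOn (coordField x i) (U ∩ (chartAt R4 x).source) :=
    SmoothVectorOn.congr (ContMDiffOn.mono (smoothVectorOn_constVec x _) Set.inter_subset_right)
      fun y hy ↦ coordField_eq hy.2 i
  have h := toChart_curvature hD hU' hc (ContMDiffOn.mono hY Set.inter_subset_left)
    (ContMDiffOn.mono hX Set.inter_subset_left) hs ⟨hx, hs⟩
  rw [coordField_eq hs, constVec, toChart_ofChart hs] at h
  have h' := (congrArg (fun L : R4 →L[ℝ] R4 ↦ L (curvature D (coordField x i) Y X x))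
    (toChart_self x)).symm.trans h
  exact congrArg (fun w : R4 ↦ w i) h'

variable {𝔤 : GalileiMetric M} {D : Connection M} {u : Π y : M, TSpace M y}

theorem IsTimelikeUnit.smoothVectorAt (hu : IsTimelikeUnit 𝔤 u) (y : M) : SmoothVectorAt u y :=
  hu.smooth.smoothVectorAt isOpen_univ (Set.mem_univ y)

theorem expansion_eq (hy : y ∈ (chartAt R4 x).source) (hu : SmoothVectorAt u y) :
    expansion D u y =
      traceL R4 (covDeriv (christoffel x D) (vecRep x u) (extChartAt (𝓡 4) x y)) := by
  have hfin : FiniteDimensional ℝ (TSpace M y) := inferInstanceAs (FiniteDimensional ℝ R4)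
  have h : ((covDeriv (christoffel x D) (vecRep x u) (extChartAt (𝓡 4) x y) : R4 →L[ℝ] R4) :
      R4 →ₗ[ℝ] R4) = (toChart x y : TSpace M y →ₗ[ℝ] R4) ∘ₗ
        ((D u y : TSpace M y →ₗ[ℝ] TSpace M y) ∘ₗ (ofChart x y : R4 →ₗ[ℝ] TSpace M y)) := by
    ext1 w
    have h1 := toChart_connection D hy hu (ofChart x y w)
    rw [toChart_ofChart hy] at h1
    exact h1.symm
  rw [traceL_apply, h, LinearMap.trace_comp_comm', expansion]
  congr 1
  ext1 v
  exact congrArg (D u y) (ofChart_toChart hy v).symm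

theorem acceleration_eventually (hu : ∀ y, SmoothVectorAt u y) (hy : y ∈ (chartAt R4 x).source)
    (ha : ∀ᶠ w in 𝓝 y, acceleration D u w = 0) : ∀ᶠ z in 𝓝 (extChartAt (𝓡 4) x y),
      covDeriv (christoffel x D) (vecRep x u) z (vecRep x u z) = 0 := by
  have hc : ContinuousAt (extChartAt (𝓡 4) x).symm (extChartAt (𝓡 4) x y) :=
    (contMDiffAt_chart_symm hy).continuousAt
  rw [ContinuousAt, chart_left_inv hy] at hc
  filter_upwards [(isOpen_extChartAt_target x).mem_nhds (extChartAt_mem_target hy), hc ha]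
    with z hz hza
  have hs := extChartAt_symm_mem_source hz
  have h := toChart_connection D hs (hu _) (u ((extChartAt (𝓡 4) x).symm z))
  rw [(extChartAt (𝓡 4) x).right_inv hz] at h
  refine h.symm.trans ?_
  have hza' : D u ((extChartAt (𝓡 4) x).symm z) (u ((extChartAt (𝓡 4) x).symm z)) = 0 := hza
  rw [hza', map_zero]

theorem covDeriv_sharpRep (hu : ∀ y, SmoothVectorAt u y) {z : R4}
    (hz : z ∈ (extChartAt (𝓡 4) x).target) (β : R4 →L[ℝ] ℝ) :
    covDeriv (christoffel x D) (vecRep x u) z (sharpRep x (fun y ↦ 𝔤.sharp y) z β) =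
      vecRep x (fun y ↦ D u y (𝔤.sharp y (constForm x β y))) z := by
  have hs := extChartAt_symm_mem_source hz
  have h := toChart_connection D hs (hu _)
    (𝔤.sharp _ (constForm x β ((extChartAt (𝓡 4) x).symm z)))
  rw [(extChartAt (𝓡 4) x).right_inv hz] at h
  exact h.symm

theorem VorticityFree.symm (h : VorticityFree 𝔤 D u) (y : M) (α β : CSpace M y) :
    α (D u y (𝔤.sharp y β)) = β (D u y (𝔤.sharp y α)) := by
  have := h y α β
  rw [vorticity] at this
  linarith

theorem VorticityFree.chart (h : VorticityFree 𝔤 D u) (hu : ∀ y, SmoothVectorAt u y) {z : R4}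
    (hz : z ∈ (extChartAt (𝓡 4) x).target) (α β : R4 →L[ℝ] ℝ) :
    α (covDeriv (christoffel x D) (vecRep x u) z (sharpRep x (fun y ↦ 𝔤.sharp y) z β)) =
      β (covDeriv (christoffel x D) (vecRep x u) z (sharpRep x (fun y ↦ 𝔤.sharp y) z α)) := by
  rw [covDeriv_sharpRep hu hz, covDeriv_sharpRep hu hz]
  exact h.symm _ (constForm x α _) (constForm x β _)

/-- Without vorticity `∇u ∘ ♯` is a symmetric tensor, so the strain is `∇u ∘ ♯`. -/
theorem VorticityFree.strain_eq (h : VorticityFree 𝔤 D u) (y : M) (β : CSpace M y) :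
    strain 𝔤 D u y β = D u y (𝔤.sharp y β) := by
  have h1 : 𝔤.sharp y (β.comp (D u y)) = D u y (𝔤.sharp y β) := by
    have hsep : ∀ v w : R4, (∀ α : R4 →L[ℝ] ℝ, α v = α w) → v = w := fun v w hvw ↦ by
      ext i
      exact hvw (EuclideanSpace.proj i)
    refine hsep _ _ fun α ↦ ?_
    have h2 := 𝔤.symm y α (β.comp (D u y))
    exact h2.trans (h.symm y α β).symm
  rw [strain, h1, ← two_smul ℝ (D u y (𝔤.sharp y β)), smul_smul]
  norm_num

theorem dirDeriv_mul {f g : M → ℝ} (hf : ContMDiffAt (𝓡 4) 𝓘(ℝ, ℝ) ∞ f y)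
    (hg : ContMDiffAt (𝓡 4) 𝓘(ℝ, ℝ) ∞ g y) (v : TSpace M y) :
    dirDeriv (fun w ↦ f w * g w) y v = dirDeriv f y v * g y + f y * dirDeriv g y v := by
  have hs := mem_chart_source R4 y
  have hfg : ContMDiffAt (𝓡 4) 𝓘(ℝ, ℝ) ∞ (fun w ↦ f w * g w) y := hf.mul hg
  rw [dirDeriv_eq hs (hf.mdifferentiableAt (by simp)),
    dirDeriv_eq hs (hg.mdifferentiableAt (by simp)),
    dirDeriv_eq hs (hfg.mdifferentiableAt (by simp))]
  have h := (hasFDerivAt_of_smooth (contDiffAt_rep hs hf)).mul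
    (hasFDerivAt_of_smooth (contDiffAt_rep hs hg))
  have h' : (fun w ↦ f w * g w) ∘ (extChartAt (𝓡 4) y).symm =
      (f ∘ (extChartAt (𝓡 4) y).symm) * (g ∘ (extChartAt (𝓡 4) y).symm) := rfl
  rw [h', h.fderiv]
  simp only [_root_.add_apply, _root_.smul_apply, smul_eq_mul, Function.comp, chart_left_inv hs]
  ring

/-- The covariant derivative of the dust tensor `ρ u ⊗ u`. -/
theorem covTensor_dustTensor {ρ : M → ℝ} (hρ : ContMDiffAt (𝓡 4) 𝓘(ℝ, ℝ) ∞ ρ y)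
    (hu : SmoothVectorAt u y) {α β : Π y : M, CSpace M y} (hα : SmoothFormAt α y)
    (hβ : SmoothFormAt β y) (v : TSpace M y) :
    covTensor D (dustTensor ρ u) α β y v = dirDeriv ρ y v * (α y (u y) * β y (u y))
      + ρ y * (β y (u y) * α y (D u y v) + α y (u y) * β y (D u y v)) := by
  have hau := hα.pairing hu
  have hbu := hβ.pairing hu
  have hab : ContMDiffAt (𝓡 4) 𝓘(ℝ, ℝ) ∞ (fun y ↦ α y (u y) * β y (u y)) y := hau.mul hbu
  have hform : ∀ α β : Π y : M, CSpace M y, SmoothFormAt α y → SmoothFormAt β y →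
      covForm D α (fun y ↦ dustTensor ρ u y (β y)) y v =
        dirDeriv (fun y ↦ α y (dustTensor ρ u y (β y))) y v
        - (ρ y * β y (u y) * α y (D u y v)
          + (dirDeriv ρ y v * β y (u y) + ρ y * dirDeriv (fun y ↦ β y (u y)) y v)
            * α y (u y)) := by
    intro α β hα hβ
    have h1 : (fun y ↦ dustTensor ρ u y (β y)) = (fun y ↦ ρ y * β y (u y)) • u := rfl
    have h2 : ContMDiffAt (𝓡 4) 𝓘(ℝ, ℝ) ∞ (fun y ↦ ρ y * β y (u y)) y := hρ.mul (hβ.pairing hu)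
    rw [covForm, h1, connection_smul D (h2.mdifferentiableAt (by simp)) hu,
      dirDeriv_mul hρ (hβ.pairing hu)]
    simp only [map_add, map_smul, smul_eq_mul]
  have h3 : (fun y ↦ α y (dustTensor ρ u y (β y))) =
      fun y ↦ ρ y * (α y (u y) * β y (u y)) := by
    funext y
    simp only [dustTensor, map_smul, smul_eq_mul]
    ring
  have h4 : (fun y ↦ β y (dustTensor ρ u y (α y))) =
      fun y ↦ ρ y * (α y (u y) * β y (u y)) := by
    funext y
    simp only [dustTensor, map_smul, smul_eq_mul]
    ring
  rw [covTensor, hform α β hα hβ, hform β α hβ hα, h4, h3, dirDeriv_mul hρ hab,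
    dirDeriv_mul hau hbu]
  ring

theorem smoothFormAt_coordForm (x : M) (i : Fin 4) : SmoothFormAt (coordForm x i) x :=
  FiberBundle.contMDiffAt_extend (𝓡 4) (R4 →L[ℝ] ℝ) (basisCovec x i)

/-- The divergence of the dust tensor: `div (ρ u ⊗ u) = (u(ρ) + ρ θ) u + ρ ∇_u u`. -/
theorem divTensor_dustTensor {ρ : M → ℝ} (hρ : ContMDiffAt (𝓡 4) 𝓘(ℝ, ℝ) ∞ ρ x)
    (hu : SmoothVectorAt u x) {α : Π y : M, CSpace M y} (hα : SmoothFormAt α x) :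
    divTensor D (dustTensor ρ u) α x =
      (dirDeriv ρ x (u x) + ρ x * expansion D u x) * α x (u x)
        + ρ x * α x (acceleration D u x) := by
  have hterm : ∀ i, covTensor D (dustTensor ρ u) α (coordForm x i) x (basisVec x i) =
      dirDeriv ρ x (basisVec x i) * (α x (u x) * basisCovec x i (u x))
      + ρ x * (basisCovec x i (u x) * α x (D u x (basisVec x i))
        + α x (u x) * basisCovec x i (D u x (basisVec x i))) := fun i ↦ by
    rw [covTensor_dustTensor hρ hu hα (smoothFormAt_coordForm x i)]
    simp only [coordForm, FiberBundle.extend_apply_self]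
  have h1 : ∑ i, dirDeriv ρ x (basisVec x i) * basisCovec x i (u x) = dirDeriv ρ x (u x) := by
    have h := congrArg (fun v ↦ dirDeriv ρ x v) (sum_basisCovec_basisVec (u x))
    simp only [dirDeriv, map_sum, map_smul] at h
    rw [dirDeriv, ← h]
    exact Finset.sum_congr rfl fun i _ ↦ mul_comm _ _
  have h2 : ∑ i, basisCovec x i (u x) * α x (D u x (basisVec x i)) =
      α x (acceleration D u x) := by
    have h := congrArg (fun v ↦ α x (D u x v)) (sum_basisCovec_basisVec (u x))
    simp only [map_sum, map_smul, smul_eq_mul] at h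
    exact h
  have h3 : ∑ i, basisCovec x i (D u x (basisVec x i)) = expansion D u x :=
    (trace_eq_sum_coord
      ((D u x : TSpace M x →L[ℝ] TSpace M x) : TSpace M x →ₗ[ℝ] TSpace M x)).symm
  rw [divTensor, Finset.sum_congr rfl fun i _ ↦ hterm i, ← h1, ← h2, ← h3]
  simp only [Fin.sum_univ_four]
  ring

end Kinematics

/-! ### Static dust solutions -/

section StaticDust

open Filter Topology

variable {M : Type*} [TopologicalSpace M] [ChartedSpace R4 M] [IsManifold (𝓡 4) ∞ M]
variable {𝔤 : GalileiMetric M} {D : Connection M} {ρ : M → ℝ} {u : Π y : M, TSpace M y}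
  {G Λ : ℝ} {x : M}

theorem finrank_R4 : Module.finrank ℝ R4 = 4 := finrank_euclideanSpace_fin

theorem IsGalileiConnection.τ_deriv (hD : IsGalileiConnection 𝔤 D) (hu : IsTimelikeUnit 𝔤 u)
    (x : M) (v : TSpace M x) : 𝔤.τ x (D u x v) = 0 := by
  have hs := mem_chart_source R4 x
  have h := (hD.isGalileiChart hu x).τ_covDeriv (extChartAt_mem_target hs) (toChart x x v)
  rwa [← toChart_connection D hs (hu.smoothVectorAt x), formRep_apply hs] at h

/-- Conservation of energy-momentum makes the dust geodesic: the `τ`-component of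
`div (ρ u ⊗ u) = 0` is the continuity equation `u(ρ) + ρ θ = 0`, and what remains is
`ρ ∇_u u = 0`. -/
theorem IsDustSolution.density_smul_acceleration (h : IsDustSolution G Λ 𝔤 D ρ u) (x : M) :
    ρ x • acceleration D u x = 0 := by
  have hs := mem_chart_source R4 x
  have hu := h.velocity.smoothVectorAt x
  have hτ : SmoothFormAt 𝔤.τ x :=
    SmoothFormOn.smoothFormAt isOpen_univ 𝔤.smooth_τ (Set.mem_univ x)
  have hcont := h.conservation Set.univ isOpen_univ 𝔤.τ 𝔤.smooth_τ x (Set.mem_univ x)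
  rw [divTensor_dustTensor (h.smooth_density x) hu hτ, h.velocity.unit, acceleration,
    h.newtonian.galilei.τ_deriv h.velocity, mul_one, mul_zero, add_zero] at hcont
  -- `dx^i` paired with the rest of the conservation law is the `i`-th component of `ρ ∇_u u`
  refine PiLp.ext fun i ↦ ?_
  have hi := h.conservation _ (chartAt R4 x).open_source (constForm x (EuclideanSpace.proj i))
    (smoothFormOn_constForm x _) x hs
  rw [divTensor_dustTensor (h.smooth_density x) hu (smoothFormAt_constForm hs _), hcont,
    zero_mul, zero_add, constForm, toChart_self] at hi
  exact hi

theorem IsDustSolution.acceleration_eventually (h : IsDustSolution G Λ 𝔤 D ρ u) (hx : ρ x ≠ 0) :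
    ∀ᶠ y in 𝓝 x, acceleration D u y = 0 := by
  filter_upwards [h.smooth_density.continuous.continuousAt.eventually_ne hx] with y hy
  exact (smul_eq_zero.1 (h.density_smul_acceleration y)).resolve_left hy

theorem IsDustSolution.ricci_eq (h : IsDustSolution G Λ 𝔤 D ρ u) {U : Set M} (hU : IsOpen U)
    {X Y : Π y : M, TSpace M y} (hX : SmoothVectorOn X U) (hY : SmoothVectorOn Y U) (hx : x ∈ U) :
    ricci D X Y x = (4 * Real.pi * G * ρ x - Λ) * (𝔤.τ x (X x) * 𝔤.τ x (Y x)) := by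
  rw [h.field U hU X Y hX hY x hx]
  simp only [dustTensor, map_smul, _root_.smul_apply, smul_eq_mul, h.velocity.unit]
  ring

/-- The derivative of the expansion in the chart. -/
theorem dirDeriv_expansion (hD : SmoothConnection D) (hu : ∀ y, SmoothVectorAt u y) (x : M)
    (v : TSpace M x) : dirDeriv (expansion D u) x v =
      fderiv ℝ (fun z ↦ traceL R4 (covDeriv (christoffel x D) (vecRep x u) z))
        (extChartAt (𝓡 4) x x) (toChart x x v) := by
  have hs := mem_chart_source R4 x
  have hsm : ContDiffAt ℝ ∞ (fun z ↦ traceL R4 (covDeriv (christoffel x D) (vecRep x u) z))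
      (extChartAt (𝓡 4) x x) :=
    (traceL R4).contDiff.contDiffAt.comp _
      (contDiffAt_covDeriv (contDiffAt_christoffel hD hs) (contDiffAt_vecRep hs (hu x)))
  have hθ : ContMDiffAt (𝓡 4) 𝓘(ℝ, ℝ) ∞ (expansion D u) x := by
    refine (contMDiffAt_comp_chart hs hsm).congr_of_eventuallyEq ?_
    filter_upwards [(chartAt R4 x).open_source.mem_nhds hs] with y hy using expansion_eq hy (hu y)
  rw [dirDeriv_eq hs (hθ.mdifferentiableAt (by simp))]
  have hev : expansion D u ∘ (extChartAt (𝓡 4) x).symm =ᶠ[𝓝 (extChartAt (𝓡 4) x x)]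
      fun z ↦ traceL R4 (covDeriv (christoffel x D) (vecRep x u) z) := by
    filter_upwards [(isOpen_extChartAt_target x).mem_nhds (extChartAt_mem_target hs)] with z hz
    rw [Function.comp, expansion_eq (extChartAt_symm_mem_source hz) (hu _),
      (extChartAt (𝓡 4) x).right_inv hz]
  rw [hev.fderiv_eq]

/-- The Raychaudhuri equation for geodesic dust with stationary expansion:
`tr (∇u)² = Λ - 4πGρ`. -/
theorem IsDustSolution.traceL_sq (h : IsDustSolution G Λ 𝔤 D ρ u)
    (hθ : ExpansionStationary D u) (ha : ∀ᶠ y in 𝓝 x, acceleration D u y = 0) :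
    traceL R4 ((covDeriv (christoffel x D) (vecRep x u) (extChartAt (𝓡 4) x x)).comp
      (covDeriv (christoffel x D) (vecRep x u) (extChartAt (𝓡 4) x x))) =
      Λ - 4 * Real.pi * G * ρ x := by
  have hs := mem_chart_source R4 x
  have hu := h.velocity.smoothVectorAt
  have hD := h.newtonian.galilei
  have h1 := trace_christoffelCurvature_self (contDiffAt_christoffel hD.smooth hs)
    (christoffel_symm hD.torsion_free hs) (contDiffAt_vecRep hs (hu x))
    (NewtonCartan.acceleration_eventually hu hs ha)
  have h2 := dirDeriv_expansion hD.smooth hu x (u x)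
  rw [hθ x, ← vecRep_apply hs] at h2
  have h3 := ricci_eq_trace hD.smooth isOpen_univ h.velocity.smooth h.velocity.smooth
    (Set.mem_univ x)
  rw [h.ricci_eq isOpen_univ h.velocity.smooth h.velocity.smooth (Set.mem_univ x),
    h.velocity.unit, ← vecRep_apply hs] at h3
  rw [← h2, ← h3] at h1
  linarith

/-- Geodesic dust with neither vorticity nor change of expansion has `4πGρ ≤ Λ`. -/
theorem IsDustSolution.density_le (h : IsDustSolution G Λ 𝔤 D ρ u) (hΩ : VorticityFree 𝔤 D u)
    (hθ : ExpansionStationary D u) (ha : ∀ᶠ y in 𝓝 x, acceleration D u y = 0) :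
    4 * Real.pi * G * ρ x ≤ Λ := by
  have hs := mem_chart_source R4 x
  have hu := h.velocity.smoothVectorAt
  have h1 := ((h.newtonian.galilei.isGalileiChart h.velocity x).covDeriv_comp_H
    (extChartAt_mem_target hs) (hΩ.chart hu (extChartAt_mem_target hs)) finrank_R4
    (NewtonCartan.acceleration_eventually hu hs ha).self_of_nhds).1
  rw [h.traceL_sq hθ ha] at h1
  linarith

/-- The equation `L_u Θ = 0` in the chart at `x`. -/
theorem StrainStationary.chart (hD : IsGalileiConnection 𝔤 D) (hu : IsTimelikeUnit 𝔤 u)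
    (hΩ : VorticityFree 𝔤 D u) (hΘ : StrainStationary 𝔤 D u) (x : M) (α β : R4 →L[ℝ] ℝ) :
    α (fderiv ℝ (covDeriv (christoffel x D) (vecRep x u)) (extChartAt (𝓡 4) x x)
          (vecRep x u (extChartAt (𝓡 4) x x))
          (sharpRep x (fun y ↦ 𝔤.sharp y) (extChartAt (𝓡 4) x x) β)
        + christoffel x D (extChartAt (𝓡 4) x x) (vecRep x u (extChartAt (𝓡 4) x x))
          (covDeriv (christoffel x D) (vecRep x u) (extChartAt (𝓡 4) x x)
            (sharpRep x (fun y ↦ 𝔤.sharp y) (extChartAt (𝓡 4) x x) β))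
        - covDeriv (christoffel x D) (vecRep x u) (extChartAt (𝓡 4) x x)
          (christoffel x D (extChartAt (𝓡 4) x x) (vecRep x u (extChartAt (𝓡 4) x x))
            (sharpRep x (fun y ↦ 𝔤.sharp y) (extChartAt (𝓡 4) x x) β))
        - (2 : ℝ) • covDeriv (christoffel x D) (vecRep x u) (extChartAt (𝓡 4) x x)
          (covDeriv (christoffel x D) (vecRep x u) (extChartAt (𝓡 4) x x)
            (sharpRep x (fun y ↦ 𝔤.sharp y) (extChartAt (𝓡 4) x x) β))) = 0 := by
  have hs := mem_chart_source R4 x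
  have hus := hu.smoothVectorAt
  have hSβ : ∀ β : R4 →L[ℝ] ℝ,
      SmoothVectorAt (fun y ↦ D u y (𝔤.sharp y (constForm x β y))) x := fun β ↦
    (smoothVectorOn_connection hD.smooth (chartAt R4 x).open_source
      (ContMDiffOn.mono hu.smooth (Set.subset_univ _)) (ContMDiffOn.clm_bundle_apply
        𝔤.smooth_sharp.contMDiffOn (smoothFormOn_constForm x β))).smoothVectorAt
      (chartAt R4 x).open_source hs
  have hrep : ∀ β : R4 →L[ℝ] ℝ,
      vecRep x (fun y ↦ D u y (𝔤.sharp y (constForm x β y))) =ᶠ[𝓝 (extChartAt (𝓡 4) x x)]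
        fun z ↦ covDeriv (christoffel x D) (vecRep x u) z
          (sharpRep x (fun y ↦ 𝔤.sharp y) z β) := fun β ↦ by
    filter_upwards [(isOpen_extChartAt_target x).mem_nhds (extChartAt_mem_target hs)] with z hz
      using (covDeriv_sharpRep hus hz β).symm
  have hbr : ∀ α β : R4 →L[ℝ] ℝ,
      constForm x α x (bracket u (fun y ↦ D u y (𝔤.sharp y (constForm x β y))) x) = _ :=
    fun α β ↦ congrArg α (bracket_eq hs (hus x) (hSβ β))
  have hdir : ∀ α β : R4 →L[ℝ] ℝ, _ := fun α β ↦ dirDeriv_constForm hs α (hSβ β) (u x)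
  have hval : ∀ β : R4 →L[ℝ] ℝ, toChart x x (D u x (𝔤.sharp x (constForm x β x))) = _ := fun β ↦
    (vecRep_apply hs fun y ↦ D u y (𝔤.sharp y (constForm x β y))).symm.trans (hrep β).self_of_nhds
  have h := hΘ _ (chartAt R4 x).open_source _ _ (smoothFormOn_constForm x β)
    (smoothFormOn_constForm x α) x hs
  simp only [lieTensor, lieForm, hΩ.strain_eq] at h
  rw [hbr, hbr, hdir, hdir, (hrep α).fderiv_eq, (hrep β).fderiv_eq, hval, hval,
    ← vecRep_apply hs] at h
  have hl := (hD.isGalileiChart hu x).lie_strain (extChartAt_mem_target hs)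
    (fun y hy ↦ hΩ.chart hus hy) α β
  have hsm := contDiffAt_vecRep hs (hSβ β)
  have hα : fderiv ℝ (fun z ↦ α (covDeriv (christoffel x D) (vecRep x u) z
      (sharpRep x (fun y ↦ 𝔤.sharp y) z β))) (extChartAt (𝓡 4) x x)
        (vecRep x u (extChartAt (𝓡 4) x x)) =
      α (fderiv ℝ (fun z ↦ covDeriv (christoffel x D) (vecRep x u) z
        (sharpRep x (fun y ↦ 𝔤.sharp y) z β)) (extChartAt (𝓡 4) x x)
        (vecRep x u (extChartAt (𝓡 4) x x))) := by
    have h1 := α.hasFDerivAt.comp _ (hasFDerivAt_of_smooth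
      (hsm.congr_of_eventuallyEq (hrep β).symm))
    exact congrArg (fun L : R4 →L[ℝ] ℝ ↦ L _) h1.fderiv
  rw [← hl, hα]
  linarith

/-- Where the velocity of a static dust solution is geodesic, it is parallel. -/
theorem IsDustSolution.covDeriv_eq_zero (h : IsDustSolution G Λ 𝔤 D ρ u) (hst : IsStatic 𝔤 D u)
    (ha : ∀ᶠ y in 𝓝 x, acceleration D u y = 0) :
    covDeriv (christoffel x D) (vecRep x u) (extChartAt (𝓡 4) x x) = 0 := by
  have hs := mem_chart_source R4 x
  have hu := h.velocity.smoothVectorAt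
  have hD := h.newtonian.galilei
  refine (hD.isGalileiChart h.velocity x).covDeriv_eq_zero_of_static (extChartAt_mem_target hs)
    finrank_R4 (NewtonCartan.acceleration_eventually hu hs ha)
    (hst.vorticity.chart hu (extChartAt_mem_target hs)) ?_
    (hst.strain.chart hD h.velocity hst.vorticity x)
  rw [vecRep_apply hs, ← dirDeriv_expansion hD.smooth hu, hst.expansion x]

theorem IsDustSolution.deriv_velocity_eq_zero (h : IsDustSolution G Λ 𝔤 D ρ u)
    (hst : IsStatic 𝔤 D u) (ha : ∀ᶠ y in 𝓝 x, acceleration D u y = 0) : D u x = 0 := by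
  have hs := mem_chart_source R4 x
  ext1 v
  rw [← ofChart_toChart hs (D u x v), toChart_connection D hs (h.velocity.smoothVectorAt x),
    h.covDeriv_eq_zero hst ha]
  simp

theorem IsDustSolution.density_eq (h : IsDustSolution G Λ 𝔤 D ρ u) (hst : IsStatic 𝔤 D u)
    (ha : ∀ᶠ y in 𝓝 x, acceleration D u y = 0) : 4 * Real.pi * G * ρ x = Λ := by
  have h1 := h.traceL_sq hst.expansion ha
  rw [h.covDeriv_eq_zero hst ha, ContinuousLinearMap.comp_zero, map_zero] at h1
  linarith

/-- Where the velocity of a static dust solution is geodesic, it is parallel and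
`4πGρ = Λ` makes the connection Ricci-flat, hence the curvature vanishes. -/
theorem IsDustSolution.flatAt (h : IsDustSolution G Λ 𝔤 D ρ u) (hst : IsStatic 𝔤 D u)
    (ha : ∀ᶠ y in 𝓝 x, acceleration D u y = 0) : FlatAt D x := by
  have hs := mem_chart_source R4 x
  have hu := h.velocity.smoothVectorAt
  have hD := h.newtonian.galilei
  have hc : ContinuousAt (extChartAt (𝓡 4) x).symm (extChartAt (𝓡 4) x x) :=
    (contMDiffAt_chart_symm hs).continuousAt
  rw [ContinuousAt, chart_left_inv hs] at hc
  -- geodesic motion near `x` is an open condition, so `u` is parallel near `x`, not only at `x`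
  have hA : ∀ᶠ z in 𝓝 (extChartAt (𝓡 4) x x),
      covDeriv (christoffel x D) (vecRep x u) z = 0 := by
    filter_upwards [(isOpen_extChartAt_target x).mem_nhds (extChartAt_mem_target hs),
      hc ha.eventually_nhds] with z hz hza
    have hzs := extChartAt_symm_mem_source hz
    ext1 w
    have h1 := toChart_connection D hzs (hu _) (ofChart x _ w)
    rw [h.deriv_velocity_eq_zero hst hza, toChart_ofChart hzs,
      (extChartAt (𝓡 4) x).right_inv hz] at h1
    exact h1.symm.trans (map_zero (toChart x _))
  have hric : ∀ w k : R4, LinearMap.trace ℝ R4 (((christoffelCurvatureₗ (christoffel x D)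
      (extChartAt (𝓡 4) x x)).flip w).flip k) = 0 := fun w k ↦ by
    have h1 := ricci_eq_trace hD.smooth (chartAt R4 x).open_source (smoothVectorOn_constVec x k)
      (smoothVectorOn_constVec x w) hs
    rw [h.ricci_eq (chartAt R4 x).open_source (smoothVectorOn_constVec x k)
      (smoothVectorOn_constVec x w) hs, h.density_eq hst ha, sub_self, zero_mul, constVec,
      constVec, toChart_ofChart hs, toChart_ofChart hs] at h1
    exact h1.symm
  intro U hU hx X Y Z hX hY hZ
  rw [← ofChart_toChart hs (curvature D X Y Z x), toChart_curvature hD.smooth hU hX hY hZ hs hx,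
    (hD.isGalileiChart h.velocity x).christoffelCurvature_eq_zero (extChartAt_mem_target hs)
      finrank_R4 hA hric, map_zero]

end StaticDust

/-! ### The Einstein universe on `ℝ⁴` -/

section EinsteinUniverse

open Filter Topology

theorem toChart_model (x y : R4) : toChart x y = ContinuousLinearMap.id ℝ R4 :=
  TangentBundle.continuousLinearMapAt_model_space x y

theorem ofChart_model (x y : R4) : ofChart x y = ContinuousLinearMap.id ℝ R4 :=
  TangentBundle.symmL_model_space x y

theorem smoothVectorOn_iff {X : Π x : R4, TSpace R4 x} {U : Set R4} :
    SmoothVectorOn X U ↔ ContDiffOn ℝ ∞ (fun x ↦ (X x : R4)) U :=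
  contMDiffOn_vectorSpace_iff_contDiffOn

theorem SmoothFormAt.contDiffAt {α : Π x : R4, CSpace R4 x} {x : R4} (hα : SmoothFormAt α x) :
    ContDiffAt ℝ ∞ (F := R4 →L[ℝ] ℝ) (fun x ↦ α x) x := by
  have h := contDiffAt_formRep (mem_chart_source R4 x) hα
  have h1 : ∀ z : R4, formRep x α z = α z := fun z ↦ by
    simp only [formRep]
    rw [ofChart_model]
    rfl
  exact h.congr_of_eventuallyEq (Eventually.of_forall fun z ↦ (h1 z).symm)

theorem differentiableAt_of_section {Y : Π x : R4, TSpace R4 x} {x : R4}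
    (hY : MDifferentiableAt (𝓡 4) ((𝓡 4).prod 𝓘(ℝ, R4))
      (fun x ↦ (⟨x, Y x⟩ : Bundle.TotalSpace R4 (TSpace R4))) x) :
    DifferentiableAt ℝ (fun x ↦ (Y x : R4)) x := by
  have h := ((trivializationAt R4 (TSpace R4) x).mdifferentiableAt_section_iff
    (𝓡 4) Y (mem_chart_source R4 x)).1 hY
  refine (mdifferentiableAt_iff_differentiableAt.1 h).congr_of_eventuallyEq
    (Eventually.of_forall fun z ↦ ?_)
  have h1 := congrArg (fun L : R4 →L[ℝ] R4 ↦ L (Y z)) (toChart_model x z)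
  exact ((trivializationAt_apply_eq_toChart (Set.mem_univ z) (Y z)).trans h1).symm

theorem smoothFormOn_const (α : R4 →L[ℝ] ℝ) (U : Set R4) :
    SmoothFormOn (fun x : R4 ↦ (α : CSpace R4 x)) U := by
  have h := smoothFormOn_constForm (M := R4) 0 α
  have h1 : constForm (M := R4) 0 α = fun x : R4 ↦ (α : CSpace R4 x) := by
    funext z
    simp only [constForm]
    rw [toChart_model]
    rfl
  rw [h1] at h
  exact ContMDiffOn.mono h fun y _ ↦ Set.mem_univ y

/-- The flat connection `∇_v Y = dY(v)` of `ℝ⁴`. -/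
noncomputable def flatConnection : Connection R4 where
  toFun Y x := fderiv ℝ (fun x ↦ (Y x : R4)) x
  isCovariantDerivativeOnUniv :=
    { add := fun {σ σ' x} hσ hσ' _ ↦ by
        exact fderiv_add (differentiableAt_of_section hσ) (differentiableAt_of_section hσ')
      leibniz := fun {σ g x} hσ hg _ ↦ by
        have h := fderiv_fun_smul (mdifferentiableAt_iff_differentiableAt.1 hg)
          (differentiableAt_of_section hσ)
        have hg' : fderiv ℝ g x = mfderiv (𝓡 4) 𝓘(ℝ, ℝ) g x := mfderiv_eq_fderiv.symm
        rw [hg'] at h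
        ext1 v
        exact congrArg (fun L : R4 →L[ℝ] R4 ↦ L v) h }

theorem flatConnection_apply (Y : Π x : R4, TSpace R4 x) (x : R4) (v : TSpace R4 x) :
    flatConnection Y x v = fderiv ℝ (fun x ↦ (Y x : R4)) x v := rfl

theorem smoothConnection_flatConnection : SmoothConnection flatConnection := by
  intro U hU
  refine ⟨fun {σ} hσ ↦ ?_⟩
  have h1 : ContDiffOn ℝ ∞ (fun x ↦ (σ x : R4)) U := smoothVectorOn_iff.1 (by simpa using! hσ)
  have h2 : ContDiffOn ℝ ∞ (fderiv ℝ (fun x ↦ (σ x : R4))) U :=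
    h1.fderiv_of_isOpen hU le_rfl
  have hb : U ⊆ (trivializationAt (R4 →L[ℝ] R4)
      (fun x : R4 ↦ TSpace R4 x →L[ℝ] TSpace R4 x) (0 : R4)).baseSet := fun y _ ↦ by
    simp only [hom_trivializationAt_baseSet, Set.mem_inter_iff]
    exact ⟨Set.mem_univ y, Set.mem_univ y⟩
  refine (Bundle.Trivialization.contMDiffOn_section_iff _ hU hb).2
    (h2.contMDiffOn.congr fun z _ ↦ ?_)
  refine (end_trivializationAt_apply (M := R4) 0 z _).trans ?_
  rw [toChart_model, ofChart_model]
  rfl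

theorem torsion_flatConnection : flatConnection.torsion = 0 := by
  refine flatConnection.torsion_eq_zero_iff.2 fun {X Y x} hX hY ↦ ?_
  exact (mlieBracket_vectorSpace _ _ _).symm

theorem christoffel_flatConnection (x : R4) : christoffel x flatConnection = 0 := by
  funext z
  ext1 v
  ext1 w
  rw [christoffel_apply]
  refine Finset.sum_eq_zero fun j _ ↦ ?_
  have h : endRep x (flatConnection (constVec x (EuclideanSpace.single j 1))) z v = 0 := by
    have h1 : (fun y ↦ (constVec x (EuclideanSpace.single j 1) y : R4)) =
        fun _ ↦ EuclideanSpace.single j 1 := by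
      funext y
      rw [constVec, ofChart_model]
      rfl
    simp only [endRep, ContinuousLinearMap.comp_apply]
    rw [flatConnection_apply, h1, toChart_model, fderiv_fun_const]
    rfl
  rw [h, smul_zero]

/-- The space metric `diag(0, 1, 1, 1)`, as a map from covectors to vectors. -/
noncomputable def flatSharp : (R4 →L[ℝ] ℝ) →L[ℝ] R4 :=
  ∑ i : Fin 3, (ContinuousLinearMap.apply ℝ ℝ (EuclideanSpace.single i.succ (1 : ℝ) : R4)).smulRight
    (EuclideanSpace.single i.succ (1 : ℝ))

theorem apply_flatSharp (α β : R4 →L[ℝ] ℝ) : α (flatSharp β) =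
    ∑ i : Fin 3, β (EuclideanSpace.single i.succ 1) * α (EuclideanSpace.single i.succ 1) := by
  simp [flatSharp]

theorem proj_zero_ne_zero : (EuclideanSpace.proj 0 : R4 →L[ℝ] ℝ) ≠ 0 := fun h ↦ by
  have h1 := congrArg (fun L : R4 →L[ℝ] ℝ ↦ L (EuclideanSpace.single 0 1)) h
  simp at h1

theorem eq_smul_of_apply_flatSharp_eq_zero {α : R4 →L[ℝ] ℝ} (h : α (flatSharp α) = 0) :
    α = α (EuclideanSpace.single 0 1) • (EuclideanSpace.proj 0 : R4 →L[ℝ] ℝ) := by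
  rw [apply_flatSharp, Finset.sum_eq_zero_iff_of_nonneg fun i _ ↦ mul_self_nonneg _] at h
  refine ContinuousLinearMap.coe_injective ((EuclideanSpace.basisFun (Fin 4) ℝ).toBasis.ext
    fun i ↦ ?_)
  refine Fin.cases ?_ (fun i ↦ ?_) i
  · simp
  · simpa using mul_self_eq_zero.1 (h i (Finset.mem_univ i))

/-- The Galilei metric `τ = dx⁰`, `h = diag(0, 1, 1, 1)` of `ℝ⁴`. -/
noncomputable def flatMetric : GalileiMetric R4 where
  τ _ := (EuclideanSpace.proj 0 : R4 →L[ℝ] ℝ)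
  sharp _ := flatSharp
  smooth_τ := smoothFormOn_const _ _
  smooth_sharp x := by
    refine contMDiffAt_sharp ((contMDiffAt_const (c := flatSharp)).congr_of_eventuallyEq
      (Eventually.of_forall fun z ↦ ?_))
    exact congrArg (fun L : R4 →L[ℝ] R4 ↦ (L.comp flatSharp).comp (ContinuousLinearMap.precomp ℝ L))
      (toChart_model x z)
  τ_ne_zero _ := proj_zero_ne_zero
  symm x α β := by
    refine (apply_flatSharp α β).trans (Eq.trans ?_ (apply_flatSharp β α).symm)
    exact Finset.sum_congr rfl fun i _ ↦ mul_comm _ _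
  nonneg x α := by
    refine le_of_le_of_eq ?_ (apply_flatSharp α α).symm
    exact Finset.sum_nonneg fun i _ ↦ mul_self_nonneg _
  sharp_τ x := by
    change flatSharp (EuclideanSpace.proj 0) = 0
    simp [flatSharp]
  null _ α h := ⟨_, eq_smul_of_apply_flatSharp_eq_zero h⟩

theorem covForm_flatSharp {α β : Π x : R4, CSpace R4 x} {x : R4}
    {α' β' : R4 →L[ℝ] R4 →L[ℝ] ℝ} (hα : HasFDerivAt (F := R4 →L[ℝ] ℝ) (fun y ↦ α y) α' x)
    (hβ : HasFDerivAt (F := R4 →L[ℝ] ℝ) (fun y ↦ β y) β' x) (v : TSpace R4 x) :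
    dirDeriv (fun y ↦ α y (flatMetric.sharp y (β y))) x v =
        α x (flatMetric.sharp x (β' v)) + α' v (flatMetric.sharp x (β x)) ∧
      covForm flatConnection α (fun y ↦ flatMetric.sharp y (β y)) x v =
        α' v (flatMetric.sharp x (β x)) := by
  have hβs := flatSharp.hasFDerivAt.comp x hβ
  have h1 : dirDeriv (fun y ↦ α y (flatMetric.sharp y (β y))) x v =
      α x (flatMetric.sharp x (β' v)) + α' v (flatMetric.sharp x (β x)) := by
    rw [dirDeriv, mfderiv_eq_fderiv]
    exact congrArg (fun L : R4 →L[ℝ] ℝ ↦ L v) (hα.clm_apply hβs).fderiv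
  have h2 : flatConnection (fun y ↦ flatMetric.sharp y (β y)) x v = flatSharp (β' v) :=
    congrArg (fun L : R4 →L[ℝ] R4 ↦ L v) hβs.fderiv
  refine ⟨h1, ?_⟩
  rw [covForm, h1, h2]
  exact add_sub_cancel_left _ _

theorem isGalileiConnection_flatConnection : IsGalileiConnection flatMetric flatConnection where
  smooth := smoothConnection_flatConnection
  torsion_free := torsion_flatConnection
  τ_parallel U hU Y hY x hx v := by
    have hYd : DifferentiableAt ℝ (fun x ↦ (Y x : R4)) x :=
      differentiableAt_of_section (hY.smoothVectorAt hU hx).mdifferentiableAt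
    have h := ((EuclideanSpace.proj 0 : R4 →L[ℝ] ℝ).hasFDerivAt.comp x hYd.hasFDerivAt).fderiv
    rw [covForm, dirDeriv, mfderiv_eq_fderiv]
    exact sub_eq_zero.2 (congrArg (fun L : R4 →L[ℝ] ℝ ↦ L v) h)
  h_parallel U hU α β hα hβ x hx v := by
    have hα' := hasFDerivAt_of_smooth (hα.smoothFormAt hU hx).contDiffAt
    have hβ' := hasFDerivAt_of_smooth (hβ.smoothFormAt hU hx).contDiffAt
    have h3 := flatMetric.symm x (α x) (fderiv ℝ (F := R4 →L[ℝ] ℝ) (fun y ↦ β y) x v)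
    rw [covTensor, (covForm_flatSharp hα' hβ' v).1, (covForm_flatSharp hα' hβ' v).2,
      (covForm_flatSharp hβ' hα' v).2]
    exact sub_eq_zero.2 ((add_sub_cancel_right _ _).trans h3)

/-- The velocity field `∂₀`. -/
noncomputable def restVelocity (x : R4) : TSpace R4 x := (EuclideanSpace.single 0 1 : R4)

theorem isTimelikeUnit_restVelocity : IsTimelikeUnit flatMetric restVelocity where
  smooth := smoothVectorOn_iff.2 contDiffOn_const
  unit x := by
    change (EuclideanSpace.proj 0 : R4 →L[ℝ] ℝ) (EuclideanSpace.single 0 1) = 1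
    simp

theorem flatConnection_restVelocity (x : R4) : flatConnection restVelocity x = 0 := by
  ext1 v
  refine (flatConnection_apply _ _ _).trans ?_
  have h : fderiv ℝ (fun _ : R4 ↦ (EuclideanSpace.single (0 : Fin 4) (1 : ℝ) : R4)) x = 0 := by
    simp
  exact congrArg (fun L : R4 →L[ℝ] R4 ↦ L v) h

theorem vorticity_restVelocity (x : R4) (α β : CSpace R4 x) :
    vorticity flatMetric flatConnection restVelocity x α β = 0 := by
  rw [vorticity, flatConnection_restVelocity]
  simp

theorem dirDeriv_const {M : Type*} [TopologicalSpace M] [ChartedSpace R4 M] (c : ℝ) (x : M)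
    (v : TSpace M x) : dirDeriv (fun _ ↦ c) x v = 0 := by
  rw [dirDeriv, mfderiv_const]
  rfl

set_option synthInstance.maxHeartbeats 200000 in
theorem isClosedTwoForm_zero : IsClosedTwoForm
    (fun x : R4 ↦ (0 : TSpace R4 x →L[ℝ] TSpace R4 x →L[ℝ] ℝ)) where
  smooth := Bundle.contMDiff_zeroSection ℝ (fun x : R4 ↦ TSpace R4 x →L[ℝ] TSpace R4 x →L[ℝ] ℝ)
  alternating x v := rfl
  closed U hU X Y Z hX hY hZ x hx := by
    simp [dirDeriv_const]

theorem isNewtonianConnection_flatConnection :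
    IsNewtonianConnection flatMetric flatConnection where
  galilei := isGalileiConnection_flatConnection
  newtonian := by
    refine ⟨restVelocity, flatConnection, _, isTimelikeUnit_restVelocity,
      ⟨isGalileiConnection_flatConnection, fun x ↦ ?_, vorticity_restVelocity⟩,
      isClosedTwoForm_zero, fun U _ Y _ x _ v ↦ ?_⟩
    · rw [acceleration, flatConnection_restVelocity]
      rfl
    · simp

/-- The Einstein universe: matter of constant density `Λ / 4πG` at rest in flat spacetime. -/
theorem isDustSolution_flat {G : ℝ} (hG : G ≠ 0) (Λ : ℝ) :
    IsDustSolution G Λ flatMetric flatConnection (fun _ ↦ Λ / (4 * Real.pi * G)) restVelocity where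
  newtonian := isNewtonianConnection_flatConnection
  smooth_density := contMDiff_const
  velocity := isTimelikeUnit_restVelocity
  conservation U hU α hα x hx := by
    rw [divTensor_dustTensor contMDiffAt_const (isTimelikeUnit_restVelocity.smoothVectorAt x)
      (hα.smoothFormAt hU hx), dirDeriv_const, acceleration, expansion,
      flatConnection_restVelocity]
    simp
  field U hU X Y hX hY x hx := by
    have h0 : ricci flatConnection X Y x = 0 := by
      rw [ricci_eq_trace smoothConnection_flatConnection hU hX hY hx, christoffel_flatConnection]
      have h1 : christoffelCurvatureₗ (0 : R4 → R4 →L[ℝ] R4 →L[ℝ] R4)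
          (extChartAt (𝓡 4) x x) = 0 := by
        ext v w k : 3
        rw [christoffelCurvatureₗ_apply, christoffelCurvature, fderiv_zero]
        simp
      rw [h1]
      exact map_zero _
    rw [h0]
    simp only [dustTensor, map_smul, _root_.smul_apply, smul_eq_mul,
      isTimelikeUnit_restVelocity.unit]
    have := Real.pi_ne_zero
    field_simp
    ring

theorem isStatic_flat : IsStatic flatMetric flatConnection restVelocity where
  vorticity := vorticity_restVelocity
  expansion x := by
    have h : expansion flatConnection restVelocity = fun _ ↦ 0 := by
      funext y
      rw [NewtonCartan.expansion, flatConnection_restVelocity]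
      exact map_zero _
    rw [h, dirDeriv_const]
  strain U hU α β hα hβ x hx := by
    have h : ∀ y β, strain flatMetric flatConnection restVelocity y β = 0 := fun y β ↦ by
      rw [NewtonCartan.strain, flatConnection_restVelocity]
      simp
    rw [lieTensor, lieForm, lieForm]
    simp only [h, map_zero]
    have h1 : (fun y : R4 ↦ (0 : TSpace R4 y)) = 0 := rfl
    rw [dirDeriv_const, bracket, h1, VectorField.mlieBracket_zero_right]
    simp

end EinsteinUniverse

end NewtonCartan

theorem mainTheorem1 (G Λ : ℝ) (hG : 0 < G) :
    -- no static dust solutions with positive density for vanishing cosmological constant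
    (Λ = 0 →
      ∀ (M : Type*) [TopologicalSpace M] [ChartedSpace NewtonCartan.R4 M] [IsManifold (𝓡 4) ∞ M]
        (𝔤 : NewtonCartan.GalileiMetric M) (D : NewtonCartan.Connection M) (ρ : M → ℝ)
        (u : Π x : M, NewtonCartan.TSpace M x),
        NewtonCartan.IsDustSolution G Λ 𝔤 D ρ u →
        NewtonCartan.VorticityFree 𝔤 D u → NewtonCartan.ExpansionStationary D u →
        ∀ x, ¬ 0 < ρ x) ∧
    -- for positive cosmological constant the only static dust solution is the Einstein universe
    (0 < Λ →
      (∀ (M : Type*) [TopologicalSpace M] [ChartedSpace NewtonCartan.R4 M] [IsManifold (𝓡 4) ∞ M]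
        (𝔤 : NewtonCartan.GalileiMetric M) (D : NewtonCartan.Connection M) (ρ : M → ℝ)
        (u : Π x : M, NewtonCartan.TSpace M x),
        NewtonCartan.IsDustSolution G Λ 𝔤 D ρ u → NewtonCartan.IsStatic 𝔤 D u →
        ∀ x, (ρ x ≠ 0 ∨ ∀ᶠ y in nhds x, NewtonCartan.acceleration D u y = 0) →
          ρ x = Λ / (4 * Real.pi * G) ∧ D u x = 0 ∧ NewtonCartan.FlatAt D x) ∧
      -- which exists on `ℝ⁴`
      ∃ (𝔤 : NewtonCartan.GalileiMetric NewtonCartan.R4)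
        (D : NewtonCartan.Connection NewtonCartan.R4) (ρ : NewtonCartan.R4 → ℝ)
        (u : Π x : NewtonCartan.R4, NewtonCartan.TSpace NewtonCartan.R4 x),
        NewtonCartan.IsDustSolution G Λ 𝔤 D ρ u ∧ NewtonCartan.IsStatic 𝔤 D u ∧
        ∀ x, ρ x = Λ / (4 * Real.pi * G)) := by
  refine ⟨?_, fun hΛ ↦ ⟨?_, ?_⟩⟩
  · intro hΛ M _ _ _ 𝔤 D ρ u h hΩ hθ x hx
    have h1 := h.density_le hΩ hθ (h.acceleration_eventually hx.ne')
    rw [hΛ] at h1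
    have h2 : 0 < 4 * Real.pi * G * ρ x := by positivity
    exact absurd h2 h1.not_gt
  · intro M _ _ _ 𝔤 D ρ u h hst x hx
    have ha := hx.elim h.acceleration_eventually id
    refine ⟨?_, h.deriv_velocity_eq_zero hst ha, h.flatAt hst ha⟩
    rw [eq_div_iff (by positivity), mul_comm]
    exact h.density_eq hst ha
  · exact ⟨NewtonCartan.flatMetric, NewtonCartan.flatConnection, fun _ ↦ Λ / (4 * Real.pi * G),
      NewtonCartan.restVelocity, NewtonCartan.isDustSolution_flat hG.ne' Λ,
      NewtonCartan.isStatic_flat, fun _ ↦ rfl⟩
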